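/- A weight function is a continuous increasing function $\omega:[0,\infty)\to[0,\infty)$ with $\omega(0)=0$ and $\lim_{t\to\infty}\omega(t)=\infty$ such that $\omega(2t)=O(\omega(t))$, $\omega(t)=O(t)$ and $\log t=o(\omega(t))$ as $t\to\infty$, and such that $\varphi(y):=\omega(e^y)$ is convex on $\mathbb{R}$. Two weight functions $\omega,\sigma$ are equivalent if $\omega(t)=O(\sigma(t))$ and $\sigma(t)=O(\omega(t))$ as $t\to\infty$. Put $\varphi^*(x):=\sup_{y\ge 0}(xy-\varphi(y))$. For open $U\subseteq\mathbb{R}^n$ and $\rho>0$ let $\mathcal{B}^\omega_\rho(U)$ be the set of $f\in C^\infty(U)$ with $\sup_{x\in U,\,\alpha\in\mathbb{N}^n}|\partial^\alpha f(x)|\exp(-\tfrac1\rho\varphi^*(\rho|\alpha|))<\infty$; the Roumieu class is $\mathcal{B}^{\{\omega\}}(U)=\bigcup_{\rho>0}\mathcal{B}^\omega_\rho(U)$ and the Beurling class is $\mathcal{B}^{(\omega)}(U)=\bigcap_{\rho>0}\mathcal{B}^\omega_\rho(U)$. A weight sequence is a positive log-convex sequence $M=(M_k)_{k\ge 0}$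 with $M_0=1$ and $M_k^{1/k}\to\infty$; it is strongly log-convex if $(M_k/k!)_k$ is log-convex. A weight matrix is a nonempty family $\mathfrak{M}$ of weight sequences, totally ordered by the pointwise order, with $k!\le M_k$ for all $M\in\mathfrak{M}$ and $k\in\mathbb{N}$. The Roumieu class $\mathcal{B}^{\{\mathfrak{M}\}}(U)$ (respectively, the Beurling class $\mathcal{B}^{(\mathfrak{M})}(U)$) consists of all $f\in C^\infty(U)$ such that for some $M\in\mathfrak{M}$ and some $\rho>0$ (respectively, for all $M\in\mathfrak{M}$ and all $\rho>0$) one has $\sup_{x\in U,\,\alpha\in\mathbb{N}^n}|\partial^\alpha f(x)|/(\rho^{|\alpha|}M_{|\alpha|})<\infty$. Equality of two classes means equality on all open subsets $U$ of all $\mathbb{R}^n$. A class $\mathcal{B}$ is stable under composition if $f\circ g\in\mathcal{B}(U)$ whenever $U\subseteq\mathbb{R}^n$ and $V\subseteq\mathbb{R}^m$ are open, $g:U\to V$ has all its components in $\mathcal{B}(U)$, and $f\in\mathcal{B}(V)$. For a weight matrix $\mathfrak{M}$ and $M,N\in\mathfrak{M}$ write $M\preceq N$ if there is $C\ge1$ such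 that $\frac{M_j}{jM_{j-1}}\le C\frac{N_k}{kN_{k-1}}$ for all $1\le j\le k$. The weight function $\omega$ is R-good if $\mathcal{B}^{\{\omega\}}=\mathcal{B}^{\{\mathfrak{M}\}}$ for some weight matrix $\mathfrak{M}$ with $\forall M\in\mathfrak{M}\ \exists N\in\mathfrak{M}: M\preceq N$, and B-good if $\mathcal{B}^{(\omega)}=\mathcal{B}^{(\mathfrak{M})}$ for some weight matrix $\mathfrak{M}$ with $\forall N\in\mathfrak{M}\ \exists M\in\mathfrak{M}: M\preceq N$. Theorem. Let $\omega$ be a weight function satisfying $\omega(t)=o(t)$ as $t\to\infty$. Then the following are equivalent. (a) $\omega$ is equivalent to a concave weight function. (b) There are $C>0$ and $t_0>0$ such that $\omega(\lambda t)\le C\lambda\,\omega(t)$ for all $\lambda\ge1$ and all $t\ge t_0$. (c) $\mathcal{B}^{\{\omega\}}$ is stable under composition. (d) $\mathcal{B}^{(\omega)}$ is stable under composition. (e) There is a weight matrix $\mathfrak{S}$ consisting of strongly log-convex weight sequences such that $\mathcal{B}^{\{\omega\}}=\mathcal{B}^{\{\mathfrak{S}\}}$. (f) There is a weight matrix $\mathfrak{S}$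 consisting of strongly log-convex weight sequences such that $\mathcal{B}^{(\omega)}=\mathcal{B}^{(\mathfrak{S})}$. (g) $\omega$ is R-good. (h) $\omega$ is B-good. -/

import Mathlib

open Set Filter Topology Asymptotics
open scoped Nat

namespace Ultradiff

noncomputable section

/-! ### Weight functions -/

/-- Weight functions `ω : [0, ∞) → [0, ∞)`, coded as functions on `ℝ` of which only the values on
`[0, ∞)` matter. Nonnegativity follows from `map_zero` and `mono`. -/
structure IsWeightFunction (ω : ℝ → ℝ) : Prop where
  cont : ContinuousOn ω (Ici 0)
  mono : MonotoneOn ω (Ici 0)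
  map_zero : ω 0 = 0
  tendsto : Tendsto ω atTop atTop
  doubling : (fun t : ℝ => ω (2 * t)) =O[atTop] ω
  isBigO_id : ω =O[atTop] (fun t : ℝ => t)
  log_isLittleO : Real.log =o[atTop] ω
  convex : ConvexOn ℝ univ (fun y : ℝ => ω (Real.exp y))

/-- Two weight functions are equivalent if `ω(t) = O(σ(t))` and `σ(t) = O(ω(t))` as `t → ∞`. -/
def WeightEquiv (ω σ : ℝ → ℝ) : Prop :=
  ω =O[atTop] σ ∧ σ =O[atTop] ω

/-- The Young conjugate `φ*(x) = sup_{y ≥ 0} (x y - φ(y))` of `φ(y) = ω(e ^ y)`. The supremum is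
finite for weight functions `ω`, since `log t = o(ω(t))`. -/
def youngConj (ω : ℝ → ℝ) (x : ℝ) : ℝ :=
  sSup ((fun y : ℝ => x * y - ω (Real.exp y)) '' Ici 0)

/-! ### Ultradifferentiable classes with global estimates -/

/-- `ℝⁿ`. -/
abbrev Rn (n : ℕ) : Type := EuclideanSpace ℝ (Fin n)

/-- The iterated partial derivative `∂_{i 0} ⋯ ∂_{i (k - 1)} f (x)`. As `i` runs through all words
of length `k`, these are the derivatives `∂^α f (x)` with `|α| = k`. -/
def iteratedPartial {n : ℕ} (f : Rn n → ℝ) (k : ℕ) (i : Fin k → Fin n) (x : Rn n) : ℝ :=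
  iteratedFDeriv ℝ k f x (fun j => EuclideanSpace.single (i j) (1 : ℝ))

/-- `sup_{x ∈ U, α} |∂^α f (x)| / w_{|α|} < ∞`, for a positive sequence `w`. -/
def DerivBound {n : ℕ} (U : Set (Rn n)) (w : ℕ → ℝ) (f : Rn n → ℝ) : Prop :=
  ∃ C : ℝ, ∀ (k : ℕ) (i : Fin k → Fin n), ∀ x ∈ U, |iteratedPartial f k i x| ≤ C * w k

/-- A family of function classes: for each `n` and each (open) `U ⊆ ℝⁿ` a set of functions on `U`,
coded as functions on `ℝⁿ` of which only the restriction to `U` matters. -/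
abbrev FunctionClass : Type := (n : ℕ) → Set (Rn n) → Set (Rn n → ℝ)

/-- The Roumieu class `B^{ω}`. -/
def roumieuWeight (ω : ℝ → ℝ) : FunctionClass := fun _ U =>
  {f | ContDiffOn ℝ (⊤ : ℕ∞) f U ∧ ∃ ρ : ℝ, 0 < ρ ∧
    DerivBound U (fun k => Real.exp (youngConj ω (ρ * k) / ρ)) f}

/-- The Beurling class `B^(ω)`. -/
def beurlingWeight (ω : ℝ → ℝ) : FunctionClass := fun _ U =>
  {f | ContDiffOn ℝ (⊤ : ℕ∞) f U ∧ ∀ ρ : ℝ, 0 < ρ →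
    DerivBound U (fun k => Real.exp (youngConj ω (ρ * k) / ρ)) f}

/-- The Roumieu class `B^{𝔐}`: the union over `M ∈ 𝔐` of the Roumieu classes `B^{M}`. -/
def roumieuMatrix (𝔐 : Set (ℕ → ℝ)) : FunctionClass := fun _ U =>
  {f | ContDiffOn ℝ (⊤ : ℕ∞) f U ∧ ∃ M ∈ 𝔐, ∃ ρ : ℝ, 0 < ρ ∧ DerivBound U (fun k => ρ ^ k * M k) f}

/-- The Beurling class `B^(𝔐)`: the intersection over `M ∈ 𝔐` of the Beurling classes `B^(M)`. -/
def beurlingMatrix (𝔐 : Set (ℕ → ℝ)) : FunctionClass := fun _ U =>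
  {f | ContDiffOn ℝ (⊤ : ℕ∞) f U ∧ ∀ M ∈ 𝔐, ∀ ρ : ℝ, 0 < ρ → DerivBound U (fun k => ρ ^ k * M k) f}

/-- Equality of two families of classes: on all open subsets of all `ℝⁿ`. -/
def SameClass (B B' : FunctionClass) : Prop :=
  ∀ (n : ℕ) (U : Set (Rn n)), IsOpen U → B n U = B' n U

/-- Stability under composition: if `U ⊆ ℝⁿ` and `V ⊆ ℝᵐ` are open, `g : U → V` has all its
components in `B(U)` and `f ∈ B(V)`, then `f ∘ g ∈ B(U)`. -/
def StableUnderComposition (B : FunctionClass) : Prop :=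
  ∀ (n m : ℕ) (U : Set (Rn n)) (V : Set (Rn m)), IsOpen U → IsOpen V →
    ∀ g : Rn n → Rn m, (∀ l : Fin m, (fun x => g x l) ∈ B n U) → MapsTo g U V →
      ∀ f ∈ B m V, f ∘ g ∈ B n U

/-! ### Weight sequences and weight matrices -/

/-- Log-convexity of a sequence (used for positive sequences). -/
def LogConvexSeq (M : ℕ → ℝ) : Prop :=
  ∀ k : ℕ, M (k + 1) ^ 2 ≤ M k * M (k + 2)

/-- Weight sequences. -/
structure IsWeightSequence (M : ℕ → ℝ) : Prop where
  pos : ∀ k, 0 < M k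
  map_zero : M 0 = 1
  root_tendsto : Tendsto (fun k : ℕ => M k ^ (1 / (k : ℝ))) atTop atTop
  logConvex : LogConvexSeq M

/-- `M` is strongly log-convex if `M_k / k!` is log-convex. -/
def StronglyLogConvex (M : ℕ → ℝ) : Prop :=
  LogConvexSeq (fun k => M k / (k ! : ℝ))

/-- Weight matrices: nonempty families of weight sequences `M ≥ (k!)_k` that are totally ordered
by the pointwise order. -/
structure IsWeightMatrix (𝔐 : Set (ℕ → ℝ)) : Prop where
  nonempty : 𝔐.Nonempty
  weightSequence : ∀ M ∈ 𝔐, IsWeightSequence M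
  factorial_le : ∀ M ∈ 𝔐, ∀ k : ℕ, (k ! : ℝ) ≤ M k
  total : ∀ M ∈ 𝔐, ∀ N ∈ 𝔐, M ≤ N ∨ N ≤ M

/-- With `μ_k = M_k / M_{k-1}` and `ν_k = N_k / N_{k-1}`:
there is `C ≥ 1` with `μ_j / j ≤ C ν_k / k` for all `1 ≤ j ≤ k`. -/
def QuotientBound (M N : ℕ → ℝ) : Prop :=
  ∃ C : ℝ, 1 ≤ C ∧ ∀ j k : ℕ, 1 ≤ j → j ≤ k →
    (M j / M (j - 1)) / (j : ℝ) ≤ C * ((N k / N (k - 1)) / (k : ℝ))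

/-- R-good weight functions. -/
def RGood (ω : ℝ → ℝ) : Prop :=
  ∃ 𝔐 : Set (ℕ → ℝ), IsWeightMatrix 𝔐 ∧ (∀ M ∈ 𝔐, ∃ N ∈ 𝔐, QuotientBound M N) ∧
    SameClass (roumieuWeight ω) (roumieuMatrix 𝔐)

/-- B-good weight functions. -/
def BGood (ω : ℝ → ℝ) : Prop :=
  ∃ 𝔐 : Set (ℕ → ℝ), IsWeightMatrix 𝔐 ∧ (∀ N ∈ 𝔐, ∃ M ∈ 𝔐, QuotientBound M N) ∧
    SameClass (beurlingWeight ω) (beurlingMatrix 𝔐)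

end

end Ultradiff

namespace Ultradiff

/-! ### Log-convex sequences -/

/-! Everything passes through (b). With t = exp y, the weight exp(φ*(ρk)/ρ) is the supremum of t^k
exp(-ω(t)/ρ) over t ≥ 1, and the proof works with this form.

Condition (b) says that every large t carries an affine majorant of ω whose value at t is comparable
to ω(t) (`exists_mem_affineMajorants`). Hence the least concave majorant is equivalent to ω, which
gives (a). Also, k! times the supremum of (ρ/b)^k exp(-a/ρ) over the affine majorants a + bs is
comparable to the weights above, up to geometric factors and a change of ρ. As a supremum of
geometric sequences it is log-convex after division by k!, which gives (e) and (f); strong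
log-convexity then gives (g) and (h).

If M ⪯ N, a strongly log-convex sequence k! s_k fits between M and C^k N
(`QuotientBound.exists_between`). Such sequences survive Faà di Bruno's formula, since products of
the s_k over the blocks of a partition collapse to s_n and the factorials sum to at most 3^n n!
(`norm_taylorComp_le`). So (g) gives (c) and (h) gives (d).

For the way back to (b), suppose that (b) fails at pairs n_i, j_i: ω(n_i j_i) is much larger than
n_i ω(j_i). A lacunary series g of terms c_i cos(j_i x), with c_i about exp(-(i+1) ω(j_i)), is in
the Beurling class and bounded by 1/2. All cosine coefficients of 1/(1-g) are nonnegative, so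
nothing cancels and the one at n_i j_i is at least of size (c_i/2)^{n_i}
(`le_integral_inv_one_sub`). Membership in the Roumieu class would force it below a multiple of
exp(-ε ω(n_i j_i)) (`exists_decay`), a contradiction. -/

lemma LogConvexSeq.monotone_ratio {s : ℕ → ℝ} (hs : LogConvexSeq s) (hpos : ∀ k, 0 < s k) :
    Monotone (fun k => s (k + 1) / s k) := by
  refine monotone_nat_of_le_succ fun k => ?_
  rw [div_le_div_iff₀ (hpos _) (hpos _)]
  have := hs k
  nlinarith

/-- Each of the p successive ratios leading from s_1 to s_{p+1} has an index no larger than its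
counterpart leading from s_m to s_{m+p}, and the ratios increase. -/
lemma LogConvexSeq.mul_le {s : ℕ → ℝ} (hs : LogConvexSeq s) (hpos : ∀ k, 0 < s k)
    {m : ℕ} (hm : 1 ≤ m) (p : ℕ) : s (p + 1) * s m ≤ s 1 * s (m + p) := by
  induction p with
  | zero => simp
  | succ p ih =>
    have h := hs.monotone_ratio hpos (show p + 1 ≤ m + p by omega)
    simp only at h
    rw [div_le_div_iff₀ (hpos _) (hpos _)] at h
    have h1 : s (p + 1 + 1) * s m * s (m + p) ≤ s 1 * s (m + (p + 1)) * s (m + p) := by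
      calc s (p + 1 + 1) * s m * s (m + p) = (s (p + 1 + 1) * s (m + p)) * s m := by ring
        _ ≤ (s (m + p + 1) * s (p + 1)) * s m := by gcongr; exact (hpos m).le
        _ = s (m + p + 1) * (s (p + 1) * s m) := by ring
        _ ≤ s (m + p + 1) * (s 1 * s (m + p)) := by gcongr; exact (hpos _).le
        _ = _ := by ring_nf
    exact le_of_mul_le_mul_right h1 (hpos _)

/-- The factors are merged into s_m one at a time. In Faà di Bruno's formula m is the number of
blocks and p_i + 1 the block sizes, so the final index is the order of the derivative. -/
lemma LogConvexSeq.mul_prod_le {s : ℕ → ℝ} (hs : LogConvexSeq s) (hpos : ∀ k, 0 < s k)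
    {ι : Type*} (p : ι → ℕ) (m : ℕ) (T : Finset ι) (hT : T.card ≤ m) :
    s m * ∏ i ∈ T, s (p i + 1) ≤ s 1 ^ T.card * s (m + ∑ i ∈ T, p i) := by
  classical
  induction T using Finset.induction_on with
  | empty => simp
  | insert i T hi ih =>
    rw [Finset.card_insert_of_notMem hi] at hT
    rw [Finset.prod_insert hi, Finset.sum_insert hi, Finset.card_insert_of_notMem hi]
    have h := hs.mul_le hpos (show 1 ≤ m + ∑ i ∈ T, p i by omega) (p i)
    calc s m * (s (p i + 1) * ∏ i ∈ T, s (p i + 1))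
        = s (p i + 1) * (s m * ∏ i ∈ T, s (p i + 1)) := by ring
      _ ≤ s (p i + 1) * (s 1 ^ T.card * s (m + ∑ i ∈ T, p i)) := by
          exact mul_le_mul_of_nonneg_left (ih (by omega)) (hpos _).le
      _ = s 1 ^ T.card * (s (p i + 1) * s (m + ∑ i ∈ T, p i)) := by ring
      _ ≤ s 1 ^ T.card * (s 1 * s (m + ∑ i ∈ T, p i + p i)) := by
          have := (hpos 1).le
          gcongr
      _ = _ := by rw [pow_succ]; ring_nf

/-! ### The Faà di Bruno formula with factorial weights -/

lemma sum_partSize {n : ℕ} (c : OrderedFinpartition n) : ∑ i, c.partSize i = n := by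
  have := c.sum_sigma_eq_sum (fun _ => 1)
  simpa using this

/-- A partition of n + 1 arises from one of n with l blocks by adding a singleton, which multiplies
the summand by l + 1, or by enlarging a block of size q, which multiplies it by q + 1. These factors
add up to 2l + n + 1 ≤ 3(n + 1). -/
lemma sum_factorial_orderedFinpartition_le (n : ℕ) :
    ∑ c : OrderedFinpartition n, (c.length ! * ∏ i, (c.partSize i)!) ≤ 3 ^ n * n ! := by
  induction n with
  | zero => simp
  | succ n ih =>
    rw [← (OrderedFinpartition.extendEquiv n).sum_comp, Fintype.sum_sigma]
    have key : ∀ c : OrderedFinpartition n,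
        ∑ o : Option (Fin c.length), ((OrderedFinpartition.extendEquiv n ⟨c, o⟩).length ! *
          ∏ i, ((OrderedFinpartition.extendEquiv n ⟨c, o⟩).partSize i)!) ≤
        3 * (n + 1) * (c.length ! * ∏ i, (c.partSize i)!) := by
      intro c
      rw [Fintype.sum_option]
      have h1 : (OrderedFinpartition.extendEquiv n ⟨c, none⟩).length ! *
          ∏ i, ((OrderedFinpartition.extendEquiv n ⟨c, none⟩).partSize i)! =
          (c.length + 1) * (c.length ! * ∏ i, (c.partSize i)!) := by
        change (c.length + 1)! * ∏ i : Fin (c.length + 1),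
          ((Fin.cons 1 c.partSize : Fin (c.length + 1) → ℕ) i)! = _
        rw [Fin.prod_univ_succ, Nat.factorial_succ]
        simp
        ring
      have h2 : ∀ k : Fin c.length, (OrderedFinpartition.extendEquiv n ⟨c, some k⟩).length ! *
          ∏ i, ((OrderedFinpartition.extendEquiv n ⟨c, some k⟩).partSize i)! =
          (c.partSize k + 1) * (c.length ! * ∏ i, (c.partSize i)!) := by
        intro k
        change c.length ! * ∏ i : Fin c.length,
          (Function.update c.partSize k (c.partSize k + 1) i)! = _
        rw [← Finset.mul_prod_erase _ _ (Finset.mem_univ k),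
          ← Finset.mul_prod_erase (a := k) _ (fun i => (c.partSize i)!) (Finset.mem_univ k)]
        rw [Function.update_self, Nat.factorial_succ]
        have : ∏ i ∈ Finset.univ.erase k, (Function.update c.partSize k (c.partSize k + 1) i)! =
            ∏ i ∈ Finset.univ.erase k, (c.partSize i)! := by
          refine Finset.prod_congr rfl fun i hi => ?_
          rw [Function.update_of_ne (Finset.ne_of_mem_erase hi)]
        rw [this]
        ring
      rw [h1, Finset.sum_congr rfl (fun k _ => h2 k), ← Finset.sum_mul, ← add_mul,
        Finset.sum_add_distrib, sum_partSize]
      refine Nat.mul_le_mul_right _ ?_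
      have := c.length_le
      simp
      omega
    calc _ ≤ ∑ c : OrderedFinpartition n, 3 * (n + 1) * (c.length ! * ∏ i, (c.partSize i)!) :=
          Finset.sum_le_sum fun c _ => key c
      _ = 3 * (n + 1) * ∑ c : OrderedFinpartition n, (c.length ! * ∏ i, (c.partSize i)!) := by
          rw [Finset.mul_sum]
      _ ≤ 3 * (n + 1) * (3 ^ n * n !) := Nat.mul_le_mul_left _ ih
      _ = _ := by rw [Nat.factorial_succ]; ring

/-- Composition of jets with bounds given by a strongly log-convex sequence `k! s_k`. -/
lemma norm_taylorComp_le {E F G : Type*} [NormedAddCommGroup E] [NormedSpace ℝ E]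
    [NormedAddCommGroup F] [NormedSpace ℝ F] [NormedAddCommGroup G] [NormedSpace ℝ G]
    (q : FormalMultilinearSeries ℝ F G) (p : FormalMultilinearSeries ℝ E F)
    {s : ℕ → ℝ} (hs : LogConvexSeq s) (hpos : ∀ k, 0 < s k) {A a B b : ℝ} (ha : 0 < a)
    (hB : 0 < B) (hb : 0 < b) (hq : ∀ l, ‖q l‖ ≤ A * (a ^ l * (l ! * s l)))
    (hp : ∀ l, ‖p l‖ ≤ B * (b ^ l * (l ! * s l))) (n : ℕ) :
    ‖q.taylorComp p n‖ ≤ A * ((3 * b * max 1 (a * B * s 1)) ^ n * (n ! * s n)) := by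
  set D := max 1 (a * B * s 1) with hD
  have hA : 0 ≤ A := by
    have h0 := (norm_nonneg _).trans (hq 0)
    have := hpos 0
    by_contra h
    push Not at h
    simp at h0
    nlinarith
  have key : ∀ c : OrderedFinpartition n, ‖q.compAlongOrderedFinpartition p c‖ ≤
      A * (b ^ n * D ^ n * s n) * ((c.length ! * ∏ i, (c.partSize i)! : ℕ) : ℝ) := by
    intro c
    have hsum := sum_partSize c
    have hps : ∀ i, c.partSize i - 1 + 1 = c.partSize i := fun i =>
      Nat.sub_add_cancel (c.partSize_pos i)
    have hsp : s c.length * ∏ i, s (c.partSize i) ≤ s 1 ^ c.length * s n := by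
      have := hs.mul_prod_le hpos (fun i => c.partSize i - 1) c.length Finset.univ (by simp)
      simp only [hps, Finset.card_univ, Fintype.card_fin] at this
      convert this using 3
      have h3 : ∑ i, c.partSize i = ∑ i, (c.partSize i - 1) + c.length := by
        rw [← Finset.sum_congr rfl (fun i _ => hps i), Finset.sum_add_distrib]
        simp
      omega
    have hprod : ∏ i, (B * (b ^ c.partSize i * ((c.partSize i)! * s (c.partSize i)))) =
        B ^ c.length * b ^ n * (∏ i, ((c.partSize i)! : ℝ)) * ∏ i, s (c.partSize i) := by
      simp only [Finset.prod_mul_distrib, Finset.prod_const, Finset.card_univ, Fintype.card_fin,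
        Finset.prod_pow_eq_pow_sum, hsum]
      ring
    -- Since D ≥ 1 and there are at most n blocks, the exponent can be made independent of the
    -- partition.
    have hD1 : (a * B * s 1) ^ c.length ≤ D ^ n := by
      calc (a * B * s 1) ^ c.length ≤ D ^ c.length := by
            gcongr
            · have := hpos 1; positivity
            · exact le_max_right _ _
        _ ≤ D ^ n := pow_le_pow_right₀ (le_max_left _ _) c.length_le
    calc ‖q.compAlongOrderedFinpartition p c‖
        ≤ ‖q c.length‖ * ∏ i, ‖p (c.partSize i)‖ := c.norm_compAlongOrderedFinpartition_le _ _
      _ ≤ (A * (a ^ c.length * (c.length ! * s c.length))) *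
          ∏ i, (B * (b ^ c.partSize i * ((c.partSize i)! * s (c.partSize i)))) := by
          gcongr
          · exact (norm_nonneg _).trans (hq _)
          · exact hq _
          · exact hp _
      _ = A * a ^ c.length * B ^ c.length * b ^ n * (c.length ! * ∏ i, ((c.partSize i)! : ℝ)) *
          (s c.length * ∏ i, s (c.partSize i)) := by rw [hprod]; ring
      _ ≤ A * a ^ c.length * B ^ c.length * b ^ n * (c.length ! * ∏ i, ((c.partSize i)! : ℝ)) *
          (s 1 ^ c.length * s n) := by gcongr
      _ = A * b ^ n * (c.length ! * ∏ i, ((c.partSize i)! : ℝ)) * s n *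
          (a * B * s 1) ^ c.length := by rw [mul_pow, mul_pow]; ring
      _ ≤ A * b ^ n * (c.length ! * ∏ i, ((c.partSize i)! : ℝ)) * s n * D ^ n := by
          have := (hpos n).le
          gcongr
      _ = _ := by push_cast; ring
  have hsn := (hpos n).le
  have hD0 : 0 ≤ D := zero_le_one.trans (le_max_left _ _)
  calc ‖q.taylorComp p n‖ ≤ ∑ c, ‖q.compAlongOrderedFinpartition p c‖ := norm_sum_le _ _
    _ ≤ ∑ c : OrderedFinpartition n, A * (b ^ n * D ^ n * s n) *
        ((c.length ! * ∏ i, (c.partSize i)! : ℕ) : ℝ) := Finset.sum_le_sum fun c _ => key c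
    _ = A * (b ^ n * D ^ n * s n) *
        ((∑ c : OrderedFinpartition n, c.length ! * ∏ i, (c.partSize i)! : ℕ) : ℝ) := by
        rw [← Finset.mul_sum]; push_cast; rfl
    _ ≤ A * (b ^ n * D ^ n * s n) * ((3 ^ n * n ! : ℕ) : ℝ) := by
        gcongr
        exact sum_factorial_orderedFinpartition_le n
    _ = _ := by push_cast; rw [mul_pow, mul_pow]; ring

end Ultradiff

namespace Ultradiff

/-! ### Partial derivatives and norms of derivatives -/

lemma abs_iteratedPartial_le {n : ℕ} (f : Rn n → ℝ) (k : ℕ) (i : Fin k → Fin n) (x : Rn n) :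
    |iteratedPartial f k i x| ≤ ‖iteratedFDeriv ℝ k f x‖ := by
  have := (iteratedFDeriv ℝ k f x).le_opNorm (fun j => EuclideanSpace.single (i j) (1 : ℝ))
  simpa [iteratedPartial] using this

/-- Expanding the k arguments in the standard basis yields n^k words, and every coordinate of a
vector is at most its norm. -/
lemma norm_iteratedFDeriv_le_of_iteratedPartial {n : ℕ} {f : Rn n → ℝ} {k : ℕ} {x : Rn n} {C : ℝ}
    (h : ∀ i : Fin k → Fin n, |iteratedPartial f k i x| ≤ C) (hC : 0 ≤ C) :
    ‖iteratedFDeriv ℝ k f x‖ ≤ (n : ℝ) ^ k * C := by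
  refine ContinuousMultilinearMap.opNorm_le_bound (by positivity) fun v => ?_
  have hv : v = fun j => ∑ l : Fin n, (v j l) • EuclideanSpace.single l (1 : ℝ) := by
    funext j
    ext l
    simp [Finset.sum_apply, Pi.single_apply]
  have hexp : iteratedFDeriv ℝ k f x v =
      ∑ i : Fin k → Fin n, (∏ j, v j (i j)) • iteratedPartial f k i x := by
    conv_lhs => rw [hv]
    rw [ContinuousMultilinearMap.map_sum]
    refine Finset.sum_congr rfl fun i _ => ?_
    rw [ContinuousMultilinearMap.map_smul_univ]
    rfl
  rw [hexp]
  calc ‖∑ i : Fin k → Fin n, (∏ j, v j (i j)) • iteratedPartial f k i x‖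
      ≤ ∑ i : Fin k → Fin n, (∏ j, ‖v j‖) * C := by
        refine norm_sum_le_of_le _ fun i _ => ?_
        rw [norm_smul, norm_prod]
        refine mul_le_mul ?_ (h i) (norm_nonneg _) (by positivity)
        exact Finset.prod_le_prod (fun _ _ => norm_nonneg _) fun j _ => PiLp.norm_apply_le _ _
    _ = _ := by simp; ring

lemma norm_iteratedFDeriv_le_sum_components {n m : ℕ} {g : Rn n → Rn m} {x : Rn n}
    (hg : ContDiffAt ℝ (⊤ : ℕ∞) g x) (k : ℕ) :
    ‖iteratedFDeriv ℝ k g x‖ ≤ ∑ l, ‖iteratedFDeriv ℝ k (fun y => g y l) x‖ := by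
  refine ContinuousMultilinearMap.opNorm_le_bound (by positivity) fun v => ?_
  have hcomp : ∀ l, iteratedFDeriv ℝ k g x v l = iteratedFDeriv ℝ k (fun y => g y l) x v := by
    intro l
    have := (EuclideanSpace.proj l : Rn m →L[ℝ] ℝ).iteratedFDeriv_comp_left
      (n := (⊤ : ℕ∞)) (i := k) hg (by exact_mod_cast le_top)
    have h2 : (fun y => g y l) = (EuclideanSpace.proj l : Rn m →L[ℝ] ℝ) ∘ g := rfl
    rw [h2, this]
    rfl
  have hsum : iteratedFDeriv ℝ k g x v =
      ∑ l, (iteratedFDeriv ℝ k g x v l) • EuclideanSpace.single l (1 : ℝ) := by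
    ext l
    simp [Finset.sum_apply, Pi.single_apply]
  rw [hsum, Finset.sum_mul]
  refine norm_sum_le_of_le _ fun l _ => ?_
  rw [norm_smul, hcomp]
  simpa using (iteratedFDeriv ℝ k (fun y => g y l) x).le_opNorm v

lemma DerivBound.mono {n : ℕ} {U : Set (Rn n)} {w w' : ℕ → ℝ} {f : Rn n → ℝ}
    (h : DerivBound U w f) (hw : ∀ k, 0 ≤ w k) {A : ℝ} (hww : ∀ k, w k ≤ A * w' k) :
    DerivBound U w' f := by
  obtain ⟨C, hC⟩ := h
  refine ⟨max C 0 * A, fun k i x hx => (hC k i x hx).trans ?_⟩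
  calc C * w k ≤ max C 0 * w k := mul_le_mul_of_nonneg_right (le_max_left _ _) (hw k)
    _ ≤ max C 0 * (A * w' k) := mul_le_mul_of_nonneg_left (hww k) (le_max_right _ _)
    _ = _ := by ring

/-- The base n + 1 in place of n stays positive in dimension zero, as `derivBound_comp` needs. -/
lemma DerivBound.exists_norm_le {n : ℕ} {U : Set (Rn n)} {w : ℕ → ℝ} {f : Rn n → ℝ}
    (h : DerivBound U w f) (hw : ∀ k, 0 ≤ w k) :
    ∃ C, 0 < C ∧ ∀ k, ∀ x ∈ U, ‖iteratedFDeriv ℝ k f x‖ ≤ C * ((n + 1 : ℝ) ^ k * w k) := by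
  obtain ⟨C, hC⟩ := h
  have hC1 : 0 < max C 1 := lt_max_of_lt_right one_pos
  refine ⟨max C 1, hC1, fun k x hx => ?_⟩
  have h1 := norm_iteratedFDeriv_le_of_iteratedPartial (C := max C 1 * w k) (fun i =>
    (hC k i x hx).trans (mul_le_mul_of_nonneg_right (le_max_left _ _) (hw k)))
    (mul_nonneg hC1.le (hw k))
  calc _ ≤ _ := h1
    _ ≤ (n + 1 : ℝ) ^ k * (max C 1 * w k) := by
        refine mul_le_mul_of_nonneg_right ?_ (mul_nonneg hC1.le (hw k))
        gcongr
        linarith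
    _ = _ := by ring

lemma exists_norm_le_of_components {n m : ℕ} {U : Set (Rn n)} (hU : IsOpen U) {w : ℕ → ℝ}
    (hw : ∀ k, 0 ≤ w k) {g : Rn n → Rn m} (hg : ContDiffOn ℝ (⊤ : ℕ∞) g U)
    (h : ∀ l, DerivBound U w (fun x => g x l)) :
    ∃ C, 0 < C ∧ ∀ k, ∀ x ∈ U, ‖iteratedFDeriv ℝ k g x‖ ≤ C * ((n + 1 : ℝ) ^ k * w k) := by
  choose C hC0 hC using fun l => (h l).exists_norm_le hw
  refine ⟨1 + ∑ l, C l, add_pos_of_pos_of_nonneg one_pos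
    (Finset.sum_nonneg fun l _ => (hC0 l).le), fun k x hx => ?_⟩
  calc _ ≤ _ := norm_iteratedFDeriv_le_sum_components (hg.contDiffAt (hU.mem_nhds hx)) k
    _ ≤ ∑ l, C l * ((n + 1 : ℝ) ^ k * w k) := Finset.sum_le_sum fun l _ => hC l k x hx
    _ = (∑ l, C l) * ((n + 1 : ℝ) ^ k * w k) := by rw [Finset.sum_mul]
    _ ≤ _ := by
        have := hw k
        rw [add_mul]
        exact le_add_of_nonneg_left (by positivity)

lemma contDiffOn_of_components {n m : ℕ} {U : Set (Rn n)} {g : Rn n → Rn m}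
    (h : ∀ l, ContDiffOn ℝ (⊤ : ℕ∞) (fun x => g x l) U) : ContDiffOn ℝ (⊤ : ℕ∞) g U :=
  (contDiffOn_piLp 2).2 h

/-! ### Composition with bounds by strongly log-convex sequences -/

lemma derivBound_comp {n m : ℕ} {U : Set (Rn n)} {V : Set (Rn m)} (hU : IsOpen U) (hV : IsOpen V)
    {g : Rn n → Rn m} {f : Rn m → ℝ} (hg : ContDiffOn ℝ (⊤ : ℕ∞) g U)
    (hf : ContDiffOn ℝ (⊤ : ℕ∞) f V) (hgUV : MapsTo g U V)
    {s : ℕ → ℝ} (hs : LogConvexSeq s) (hpos : ∀ k, 0 < s k) {A a B b : ℝ} (ha : 0 < a)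
    (hB : 0 < B) (hb : 0 < b)
    (hfb : ∀ k, ∀ y ∈ V, ‖iteratedFDeriv ℝ k f y‖ ≤ A * (a ^ k * (k ! * s k)))
    (hgb : ∀ k, ∀ x ∈ U, ‖iteratedFDeriv ℝ k g x‖ ≤ B * (b ^ k * (k ! * s k))) :
    DerivBound U (fun k => (3 * b * max 1 (a * B * s 1)) ^ k * (k ! * s k)) (f ∘ g) := by
  refine ⟨A, fun k i x hx => (abs_iteratedPartial_le _ _ _ _).trans ?_⟩
  rw [iteratedFDeriv_comp (n := (⊤ : ℕ∞)) (hf.contDiffAt (hV.mem_nhds (hgUV hx)))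
    (hg.contDiffAt (hU.mem_nhds hx)) (by exact_mod_cast le_top)]
  exact norm_taylorComp_le _ _ hs hpos ha hB hb (fun l => hfb l _ (hgUV hx))
    (fun l => hgb l x hx) k

/-- The running maximum of μ_j / j is the least increasing sequence above μ_j / j, and the quotient
bound says exactly that it stays below C ν_k / k. Its partial products are the required s. -/
lemma QuotientBound.exists_between {M N : ℕ → ℝ} (h : QuotientBound M N) (hM : IsWeightSequence M)
    (hN : IsWeightSequence N) : ∃ s : ℕ → ℝ, LogConvexSeq s ∧ (∀ k, 0 < s k) ∧
      (∀ k, M k ≤ k ! * s k) ∧ ∃ C : ℝ, 1 ≤ C ∧ ∀ k, k ! * s k ≤ C ^ k * N k := by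
  obtain ⟨C, hC1, hC⟩ := h
  have hMp := hM.pos
  have hNp := hN.pos
  -- Indices are shifted by one: `μ j` is the quotient belonging to j + 1.
  set μ : ℕ → ℝ := fun j => M (j + 1) / M j / (j + 1 : ℝ) with hμ
  have hμpos : ∀ j, 0 < μ j := fun j => by
    have := hMp j
    have := hMp (j + 1)
    positivity
  set r : ℕ → ℝ := fun k => partialSups μ k with hr
  have hμr : ∀ k, μ k ≤ r k := fun k => le_partialSups μ k
  have hrpos : ∀ k, 0 < r k := fun k => (hμpos k).trans_le (hμr k)
  have hrmono : Monotone r := (partialSups μ).monotone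
  have hrN : ∀ k, r k ≤ C * (N (k + 1) / N k / (k + 1 : ℝ)) := by
    intro k
    refine partialSups_le _ _ _ fun j hj => ?_
    simpa [hμ] using hC (j + 1) (k + 1) (by omega) (by omega)
  set s : ℕ → ℝ := fun k => ∏ i ∈ Finset.range k, r i with hs
  have hspos : ∀ k, 0 < s k := fun k => Finset.prod_pos fun i _ => hrpos i
  have hsucc : ∀ k, s (k + 1) = s k * r k := fun k => Finset.prod_range_succ _ _
  refine ⟨s, fun k => ?_, hspos, fun k => ?_, C, hC1, fun k => ?_⟩
  · rw [hsucc (k + 1), hsucc k]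
    have h1 := hrmono (Nat.le_succ k)
    have h2 := hspos k
    have h3 := hrpos k
    calc (s k * r k) ^ 2 = s k * (s k * r k * r k) := by ring
      _ ≤ s k * (s k * r k * r (k + 1)) := by gcongr
  · induction k with
    | zero => simp [hs, hM.map_zero]
    | succ k ih =>
      have h1 : M (k + 1) = M k * ((k + 1 : ℝ) * μ k) := by
        have := (hMp k).ne'
        simp only [hμ]
        field_simp
      rw [h1, hsucc, Nat.factorial_succ]
      have := (hMp k).le
      have := (hspos k).le
      calc M k * ((k + 1 : ℝ) * μ k) ≤ (k ! * s k) * ((k + 1 : ℝ) * r k) := by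
            gcongr
            · exact mul_nonneg (by positivity) (hμpos k).le
            · exact hμr k
        _ = _ := by push_cast; ring
  · induction k with
    | zero => simp [hs, hN.map_zero]
    | succ k ih =>
      have h1 : C ^ (k + 1) * N (k + 1) =
          (C ^ k * N k) * ((k + 1 : ℝ) * (C * (N (k + 1) / N k / (k + 1 : ℝ)))) := by
        have := (hNp k).ne'
        field_simp
        ring
      rw [h1, hsucc, Nat.factorial_succ]
      have := (hrpos k).le
      have := (hNp k).le
      calc (((k + 1) * k ! : ℕ) : ℝ) * (s k * r k) = (k ! * s k) * ((k + 1 : ℝ) * r k) := by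
            push_cast; ring
        _ ≤ _ := by
            gcongr
            exact hrN k

/-- The numbers μ_k / k are the successive ratios of S_k / k!, hence increasing, and C = 1 works. -/
lemma QuotientBound.of_stronglyLogConvex {S : ℕ → ℝ} (hS : StronglyLogConvex S)
    (hpos : ∀ k, 0 < S k) : QuotientBound S S := by
  refine ⟨1, le_rfl, fun j k hj hjk => ?_⟩
  have hmono := LogConvexSeq.monotone_ratio hS (fun k => div_pos (hpos k) (by positivity))
  have key : ∀ i : ℕ, S (i + 1) / ((i + 1)! : ℝ) / (S i / (i ! : ℝ)) =
      S (i + 1) / S i / ((i + 1 : ℕ) : ℝ) := by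
    intro i
    have := (hpos i).ne'
    rw [Nat.factorial_succ]
    push_cast
    field_simp
  obtain ⟨j, rfl⟩ := Nat.exists_eq_add_of_le' hj
  obtain ⟨k, rfl⟩ := Nat.exists_eq_add_of_le' (hj.trans hjk)
  have := hmono (show j ≤ k by omega)
  simp only [key] at this
  simpa using this

lemma SameClass.stable {B B' : FunctionClass} (h : SameClass B B') (hB : StableUnderComposition B') :
    StableUnderComposition B := by
  intro n m U V hU hV g hg hgUV f hf
  rw [h n U hU] at hg ⊢
  rw [h m V hV] at hf
  exact hB n m U V hU hV g hg hgUV f hf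

/-- The components of the inner map each come with their own sequence and rate; total order of the
matrix lets the largest serve all. The lower bound `M₀` is there for the sequence of the outer
function. -/
lemma IsWeightMatrix.exists_common {𝔐 : Set (ℕ → ℝ)} (h𝔐 : IsWeightMatrix 𝔐) {ι : Type*}
    {n : ℕ} {U : Set (Rn n)} {g : ι → Rn n → ℝ}
    (hg : ∀ l, ∃ M ∈ 𝔐, ∃ ρ : ℝ, 0 < ρ ∧ DerivBound U (fun k => ρ ^ k * M k) (g l))
    {M₀ : ℕ → ℝ} (hM₀ : M₀ ∈ 𝔐) (T : Finset ι) :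
    ∃ M ∈ 𝔐, M₀ ≤ M ∧ ∃ ρ : ℝ, 0 < ρ ∧ ∀ l ∈ T, DerivBound U (fun k => ρ ^ k * M k) (g l) := by
  classical
  induction T using Finset.induction_on with
  | empty => exact ⟨M₀, hM₀, le_rfl, 1, one_pos, by simp⟩
  | insert i T hi ih =>
    obtain ⟨M, hM, hM₀M, ρ, hρ, hT⟩ := ih
    obtain ⟨M', hM', ρ', hρ', hi'⟩ := hg i
    have hup : ∀ {N N' : ℕ → ℝ} {σ σ' : ℝ} {f : Rn n → ℝ}, N ∈ 𝔐 → N ≤ N' → 0 < σ → σ ≤ σ' →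
        DerivBound U (fun k => σ ^ k * N k) f → DerivBound U (fun k => σ' ^ k * N' k) f := by
      intro N N' σ σ' f hN hNN hσ hσσ hb
      have hNpos := (h𝔐.weightSequence N hN).pos
      refine hb.mono (A := 1) (fun k => ?_) (fun k => ?_)
      · have := hNpos k
        positivity
      · have := (hNpos k).le
        have := hNN k
        have : 0 ≤ σ' := hσ.le.trans hσσ
        rw [one_mul]
        gcongr
    have hfin : ∀ N ∈ 𝔐, M ≤ N → M' ≤ N → ∃ M ∈ 𝔐, M₀ ≤ M ∧ ∃ ρ : ℝ, 0 < ρ ∧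
        ∀ l ∈ insert i T, DerivBound U (fun k => ρ ^ k * M k) (g l) := by
      intro N hN h1 h2
      refine ⟨N, hN, hM₀M.trans h1, max ρ ρ', lt_max_of_lt_left hρ, fun l hl => ?_⟩
      rcases Finset.mem_insert.1 hl with rfl | hl
      · exact hup hM' h2 hρ' (le_max_right _ _) hi'
      · exact hup hM h1 hρ (le_max_left _ _) (hT l hl)
    rcases h𝔐.total M hM M' hM' with h | h
    · exact hfin M' hM' h le_rfl
    · exact hfin M hM le_rfl h

/-! ### Stability of matrix classes under composition. -/

theorem stableUnderComposition_roumieuMatrix {𝔐 : Set (ℕ → ℝ)} (h𝔐 : IsWeightMatrix 𝔐)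
    (hq : ∀ M ∈ 𝔐, ∃ N ∈ 𝔐, QuotientBound M N) : StableUnderComposition (roumieuMatrix 𝔐) := by
  intro n m U V hU hV g hg hgUV f hf
  obtain ⟨hfs, M₀, hM₀, ρ₀, hρ₀, hfb⟩ := hf
  obtain ⟨M, hM, hM₀M, ρ, hρ, hgb⟩ := h𝔐.exists_common (fun l => (hg l).2) hM₀ Finset.univ
  obtain ⟨N, hN, hMN⟩ := hq M hM
  have hMpos := (h𝔐.weightSequence M hM).pos
  have hM₀pos := (h𝔐.weightSequence M₀ hM₀).pos
  obtain ⟨s, hs, hspos, hMs, C, hC1, hsN⟩ :=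
    hMN.exists_between (h𝔐.weightSequence M hM) (h𝔐.weightSequence N hN)
  have hgs : ContDiffOn ℝ (⊤ : ℕ∞) g U := contDiffOn_of_components fun l => (hg l).1
  obtain ⟨B, hB, hgB⟩ := exists_norm_le_of_components hU (w := fun k => ρ ^ k * M k)
    (fun k => by have := hMpos k; positivity) hgs (fun l => hgb l (Finset.mem_univ l))
  obtain ⟨A, hA, hfA⟩ := hfb.exists_norm_le (fun k => by have := hM₀pos k; positivity)
  have hcomp := derivBound_comp hU hV hgs hfs hgUV hs hspos (A := A) (a := (m + 1) * ρ₀)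
    (B := B) (b := (n + 1) * ρ) (by positivity) hB (by positivity)
    (fun k y hy => by
      refine (hfA k y hy).trans ?_
      rw [mul_pow, mul_assoc]
      gcongr
      exact (hM₀M k).trans (hMs k))
    (fun k x hx => by
      refine (hgB k x hx).trans ?_
      rw [mul_pow, mul_assoc]
      gcongr
      exact hMs k)
  refine ⟨hfs.comp hgs hgUV, N, hN, (3 * ((n + 1) * ρ) * max 1 ((m + 1) * ρ₀ * B * s 1)) * C, ?_,
    hcomp.mono (A := 1) (fun k => ?_) (fun k => ?_)⟩
  · have : 0 < max 1 ((m + 1) * ρ₀ * B * s 1) := lt_max_of_lt_left one_pos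
    positivity
  · have := hspos k
    positivity
  · rw [one_mul, mul_pow _ C, mul_assoc (_ ^ k)]
    refine mul_le_mul_of_nonneg_left (hsN k) ?_
    have : 0 < max 1 ((m + 1) * ρ₀ * B * s 1) := lt_max_of_lt_left one_pos
    positivity

theorem stableUnderComposition_beurlingMatrix {𝔐 : Set (ℕ → ℝ)} (h𝔐 : IsWeightMatrix 𝔐)
    (hq : ∀ N ∈ 𝔐, ∃ M ∈ 𝔐, QuotientBound M N) : StableUnderComposition (beurlingMatrix 𝔐) := by
  intro n m U V hU hV g hg hgUV f hf
  obtain ⟨hfs, hfb⟩ := hf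
  have hgs : ContDiffOn ℝ (⊤ : ℕ∞) g U := contDiffOn_of_components fun l => (hg l).1
  refine ⟨hfs.comp hgs hgUV, fun N hN σ hσ => ?_⟩
  obtain ⟨M, hM, hMN⟩ := hq N hN
  have hMpos := (h𝔐.weightSequence M hM).pos
  have hNpos := (h𝔐.weightSequence N hN).pos
  obtain ⟨s, hs, hspos, hMs, C, hC1, hsN⟩ :=
    hMN.exists_between (h𝔐.weightSequence M hM) (h𝔐.weightSequence N hN)
  have hC0 : 0 < C := one_pos.trans_le hC1
  have hs1 := hspos 1
  -- The final rate is 3bC max(1, a B s_1) with b = (n + 1)ρ. This choice makes it σ once the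
  -- maximum is 1.
  obtain ⟨ρ, hρ, hρσ⟩ : ∃ ρ : ℝ, 0 < ρ ∧ 3 * ((n + 1) * ρ) * C = σ :=
    ⟨σ / (3 * (n + 1) * C), by positivity, by field_simp⟩
  obtain ⟨B, hB, hgB⟩ := exists_norm_le_of_components hU (w := fun k => ρ ^ k * M k)
    (fun k => by have := hMpos k; positivity) hgs (fun l => (hg l).2 M hM ρ hρ)
  -- The rate for `f` is chosen after `B` is known, so that the maximum is indeed 1.
  obtain ⟨ρ₀, hρ₀, hρ₀B⟩ : ∃ ρ₀ : ℝ, 0 < ρ₀ ∧ (m + 1) * ρ₀ * B * s 1 = 1 :=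
    ⟨1 / ((m + 1) * B * s 1), by positivity, by field_simp⟩
  obtain ⟨A, hA, hfA⟩ := (hfb M hM ρ₀ hρ₀).exists_norm_le
    (fun k => by have := hMpos k; positivity)
  have hcomp := derivBound_comp hU hV hgs hfs hgUV hs hspos (A := A) (a := (m + 1) * ρ₀)
    (B := B) (b := (n + 1) * ρ) (by positivity) hB (by positivity)
    (fun k y hy => by
      refine (hfA k y hy).trans ?_
      rw [mul_pow, mul_assoc]
      gcongr
      exact hMs k)
    (fun k x hx => by
      refine (hgB k x hx).trans ?_
      rw [mul_pow, mul_assoc]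
      gcongr
      exact hMs k)
  rw [hρ₀B, max_self, mul_one] at hcomp
  refine hcomp.mono (A := 1) (fun k => ?_) (fun k => ?_)
  · have := hspos k
    positivity
  · rw [one_mul, ← hρσ, mul_pow _ C, mul_assoc (_ ^ k)]
    exact mul_le_mul_of_nonneg_left (hsN k) (by positivity)

theorem RGood.stable {ω : ℝ → ℝ} (h : RGood ω) : StableUnderComposition (roumieuWeight ω) := by
  obtain ⟨𝔐, h𝔐, hq, hsame⟩ := h
  exact hsame.stable (stableUnderComposition_roumieuMatrix h𝔐 hq)

theorem BGood.stable {ω : ℝ → ℝ} (h : BGood ω) : StableUnderComposition (beurlingWeight ω) := by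
  obtain ⟨𝔐, h𝔐, hq, hsame⟩ := h
  exact hsame.stable (stableUnderComposition_beurlingMatrix h𝔐 hq)

end Ultradiff

namespace Ultradiff

/-! ### The weight sequences associated with a weight function -/

/-- `exp (φ*(ρ k) / ρ)`, the `k`-th entry of the weight sequence of parameter `ρ`. -/
noncomputable def weightSeq (ω : ℝ → ℝ) (ρ : ℝ) (k : ℕ) : ℝ := Real.exp (youngConj ω (ρ * k) / ρ)

lemma weightSeq_pos (ω : ℝ → ℝ) (ρ : ℝ) (k : ℕ) : 0 < weightSeq ω ρ k := Real.exp_pos _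

namespace IsWeightFunction

variable {ω : ℝ → ℝ}

lemma nonneg (hω : IsWeightFunction ω) {t : ℝ} (ht : 0 ≤ t) : 0 ≤ ω t := by
  rw [← hω.map_zero]
  exact hω.mono (mem_Ici.2 le_rfl) ht ht

lemma le_of_le (hω : IsWeightFunction ω) {s t : ℝ} (hs : 0 ≤ s) (hst : s ≤ t) : ω s ≤ ω t :=
  hω.mono hs (mem_Ici.2 (hs.trans hst)) hst

lemma exists_mul_log_le (hω : IsWeightFunction ω) {x : ℝ} (hx : 0 ≤ x) :
    ∃ D : ℝ, 0 ≤ D ∧ ∀ t : ℝ, 1 ≤ t → x * Real.log t ≤ ω t + D := by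
  have h := hω.log_isLittleO.bound (show (0 : ℝ) < 1 / (x + 1) by positivity)
  obtain ⟨T, hT⟩ := eventually_atTop.1 h
  refine ⟨x * Real.log (max T 1), mul_nonneg hx (Real.log_nonneg (le_max_right _ _)),
    fun t ht => ?_⟩
  have h0 := hω.nonneg (zero_le_one.trans ht)
  rcases le_total T t with h1 | h1
  · have h2 := hT t h1
    rw [Real.norm_of_nonneg (Real.log_nonneg ht), Real.norm_of_nonneg h0, one_div_mul_eq_div,
      le_div_iff₀ (by positivity)] at h2
    have h3 : 0 ≤ x * Real.log (max T 1) :=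
      mul_nonneg hx (Real.log_nonneg (le_max_right _ _))
    have := Real.log_nonneg ht
    nlinarith
  · have : Real.log t ≤ Real.log (max T 1) :=
      Real.log_le_log (by linarith) (h1.trans (le_max_left _ _))
    have := mul_le_mul_of_nonneg_left this hx
    linarith

lemma bddAbove_youngConj (hω : IsWeightFunction ω) {x : ℝ} (hx : 0 ≤ x) :
    BddAbove ((fun y : ℝ => x * y - ω (Real.exp y)) '' Ici 0) := by
  obtain ⟨D, -, hD⟩ := hω.exists_mul_log_le hx
  refine ⟨D, ?_⟩
  rintro _ ⟨y, hy, rfl⟩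
  have := hD (Real.exp y) (Real.one_le_exp hy)
  rw [Real.log_exp] at this
  simp only
  linarith

/-- Substituting y = log t in the Young conjugate. With its converse `weightSeq_le`, this identifies
the weight as a supremum over t ≥ 1; later arguments use only this description. -/
lemma pow_mul_exp_le_weightSeq (hω : IsWeightFunction ω) {ρ : ℝ} (hρ : 0 < ρ) {t : ℝ}
    (ht : 1 ≤ t) (k : ℕ) : t ^ k * Real.exp (-(ω t / ρ)) ≤ weightSeq ω ρ k := by
  have ht0 : 0 < t := one_pos.trans_le ht
  have h := le_csSup (hω.bddAbove_youngConj (x := ρ * k) (by positivity))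
    ⟨Real.log t, Real.log_nonneg ht, rfl⟩
  simp only [Real.exp_log ht0] at h
  rw [← Real.exp_log (pow_pos ht0 k), ← Real.exp_add, Real.log_pow, weightSeq]
  refine Real.exp_le_exp.2 ?_
  rw [le_div_iff₀ hρ]
  calc _ = ρ * k * Real.log t - ω t := by field_simp; ring
    _ ≤ _ := h

lemma weightSeq_le {ρ : ℝ} (hρ : 0 < ρ) {k : ℕ} {B : ℝ} (hB : 0 < B)
    (h : ∀ t : ℝ, 1 ≤ t → t ^ k * Real.exp (-(ω t / ρ)) ≤ B) : weightSeq ω ρ k ≤ B := by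
  rw [weightSeq, ← Real.le_log_iff_exp_le hB, div_le_iff₀ hρ]
  refine csSup_le (Nonempty.image _ ⟨0, mem_Ici.2 le_rfl⟩) ?_
  rintro _ ⟨y, hy, rfl⟩
  have h1 := h (Real.exp y) (Real.one_le_exp hy)
  rw [← Real.exp_nat_mul, ← Real.exp_add, ← Real.le_log_iff_exp_le hB] at h1
  simp only
  calc _ = (k * y + -(ω (Real.exp y) / ρ)) * ρ := by field_simp; ring
    _ ≤ _ := mul_le_mul_of_nonneg_right h1 hρ.le

/-- For t ≤ 1 the left side is at most 1, while t = 1 shows that the weight is at least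
exp(-ω(1)/ρ); as ω(1) need not vanish, a constant is lost. -/
lemma pow_mul_exp_le (hω : IsWeightFunction ω) {ρ : ℝ} (hρ : 0 < ρ) {t : ℝ}
    (ht : 0 ≤ t) (k : ℕ) :
    t ^ k * Real.exp (-(ω t / ρ)) ≤ Real.exp (ω 1 / ρ) * weightSeq ω ρ k := by
  have h1 : 0 ≤ ω 1 / ρ := div_nonneg (hω.nonneg zero_le_one) hρ.le
  rcases le_total 1 t with h | h
  · refine (hω.pow_mul_exp_le_weightSeq hρ h k).trans ?_
    exact le_mul_of_one_le_left (weightSeq_pos _ _ _).le (Real.one_le_exp h1)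
  · have h2 := hω.pow_mul_exp_le_weightSeq hρ le_rfl k
    have h3 : Real.exp (-(ω t / ρ)) ≤ 1 :=
      Real.exp_le_one_iff.2 (neg_nonpos.2 (div_nonneg (hω.nonneg ht) hρ.le))
    calc t ^ k * Real.exp (-(ω t / ρ)) ≤ 1 * 1 :=
          mul_le_mul (pow_le_one₀ ht h) h3 (Real.exp_pos _).le zero_le_one
      _ = Real.exp (ω 1 / ρ) * (1 ^ k * Real.exp (-(ω 1 / ρ))) := by
          rw [one_pow, one_mul, one_mul, ← Real.exp_add]; simp
      _ ≤ _ := mul_le_mul_of_nonneg_left h2 (Real.exp_pos _).le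

lemma exists_le_two_mul (hω : IsWeightFunction ω) :
    ∃ L : ℝ, 1 ≤ L ∧ ∃ D : ℝ, 0 ≤ D ∧ ∀ t : ℝ, 0 ≤ t → ω (2 * t) ≤ L * ω t + D := by
  obtain ⟨c, hc⟩ := hω.doubling.bound
  obtain ⟨T, hT⟩ := eventually_atTop.1 hc
  have hD : 0 ≤ ω (2 * max T 0) := hω.nonneg (by positivity)
  refine ⟨max c 1, le_max_right _ _, ω (2 * max T 0), hD, fun t ht => ?_⟩
  have h0 := hω.nonneg ht
  rcases le_total T t with h | h
  · have h1 := hT t h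
    rw [Real.norm_of_nonneg (hω.nonneg (by positivity)), Real.norm_of_nonneg h0] at h1
    have := mul_le_mul_of_nonneg_right (le_max_left c 1) h0
    linarith
  · have h1 : ω (2 * t) ≤ ω (2 * max T 0) :=
      hω.le_of_le (by positivity) (by gcongr; exact h.trans (le_max_left _ _))
    have : 0 ≤ max c 1 * ω t := mul_nonneg (zero_le_one.trans (le_max_right _ _)) h0
    linarith

lemma exists_le_mul (hω : IsWeightFunction ω) {c : ℝ} (hc : 0 ≤ c) :
    ∃ L : ℝ, 1 ≤ L ∧ ∃ D : ℝ, 0 ≤ D ∧ ∀ t : ℝ, 0 ≤ t → ω (c * t) ≤ L * ω t + D := by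
  have hpow : ∀ m : ℕ, ∃ L : ℝ, 1 ≤ L ∧ ∃ D : ℝ, 0 ≤ D ∧
      ∀ t : ℝ, 0 ≤ t → ω (2 ^ m * t) ≤ L * ω t + D := by
    intro m
    induction m with
    | zero => exact ⟨1, le_rfl, 0, le_rfl, fun t _ => by simp⟩
    | succ m ih =>
      obtain ⟨L, hL, D, hD, h⟩ := ih
      obtain ⟨L', hL', D', hD', h'⟩ := hω.exists_le_two_mul
      refine ⟨L' * L, one_le_mul_of_one_le_of_one_le hL' hL, L' * D + D', by positivity,
        fun t ht => ?_⟩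
      calc ω (2 ^ (m + 1) * t) = ω (2 * (2 ^ m * t)) := by ring_nf
        _ ≤ L' * ω (2 ^ m * t) + D' := h' _ (by positivity)
        _ ≤ L' * (L * ω t + D) + D' := by gcongr; exact h t ht
        _ = _ := by ring
  obtain ⟨m, hm⟩ := pow_unbounded_of_one_lt c (one_lt_two (α := ℝ))
  obtain ⟨L, hL, D, hD, h⟩ := hpow m
  refine ⟨L, hL, D, hD, fun t ht => ?_⟩
  refine le_trans (hω.le_of_le (by positivity) ?_) (h t ht)
  gcongr

/-- Geometric factors are absorbed by a change of the parameter of the weight sequence. -/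
lemma exists_pow_mul_weightSeq_le (hω : IsWeightFunction ω) {c : ℝ} (hc : 0 ≤ c) :
    ∃ L : ℝ, 1 ≤ L ∧ ∀ ρ : ℝ, 0 < ρ → ∃ C : ℝ, 0 < C ∧
      ∀ k, c ^ k * weightSeq ω ρ k ≤ C * weightSeq ω (L * ρ) k := by
  rcases hc.eq_or_lt with rfl | hc'
  · refine ⟨1, le_rfl, fun ρ hρ => ⟨1, one_pos, fun k => ?_⟩⟩
    rw [one_mul, one_mul]
    exact mul_le_of_le_one_left (weightSeq_pos _ _ _).le (pow_le_one₀ le_rfl zero_le_one)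
  obtain ⟨L, hL, D, hD, h⟩ := hω.exists_le_mul hc
  have hL0 : 0 < L := one_pos.trans_le hL
  refine ⟨L, hL, fun ρ hρ => ⟨Real.exp (D / (L * ρ)) * Real.exp (ω 1 / (L * ρ)), by positivity,
    fun k => ?_⟩⟩
  rw [mul_comm, ← le_div_iff₀ (by positivity)]
  refine weightSeq_le hρ (by have := weightSeq_pos ω (L * ρ) k; positivity) fun t ht => ?_
  rw [le_div_iff₀ (by positivity)]
  have h1 := hω.pow_mul_exp_le (show 0 < L * ρ by positivity) (t := c * t) (by positivity) k
  have h2 : -(ω t / ρ) ≤ D / (L * ρ) + -(ω (c * t) / (L * ρ)) := by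
    have := h t (by linarith)
    rw [← sub_nonneg]
    have e : D / (L * ρ) + -(ω (c * t) / (L * ρ)) - -(ω t / ρ) =
        (L * ω t + D - ω (c * t)) / (L * ρ) := by field_simp; ring
    rw [e]
    exact div_nonneg (by linarith) (by positivity)
  calc t ^ k * Real.exp (-(ω t / ρ)) * c ^ k = (c * t) ^ k * Real.exp (-(ω t / ρ)) := by
        rw [mul_pow]; ring
    _ ≤ (c * t) ^ k * (Real.exp (D / (L * ρ)) * Real.exp (-(ω (c * t) / (L * ρ)))) := by
        rw [← Real.exp_add]
        exact mul_le_mul_of_nonneg_left (Real.exp_le_exp.2 h2) (by positivity)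
    _ = Real.exp (D / (L * ρ)) * ((c * t) ^ k * Real.exp (-(ω (c * t) / (L * ρ)))) := by ring
    _ ≤ Real.exp (D / (L * ρ)) * (Real.exp (ω 1 / (L * ρ)) * weightSeq ω (L * ρ) k) := by gcongr
    _ = _ := by ring

lemma exists_le_mul_add (hω : IsWeightFunction ω) (hωo : ω =o[atTop] (fun t : ℝ => t)) {ε : ℝ}
    (hε : 0 < ε) : ∃ D : ℝ, 0 ≤ D ∧ ∀ t : ℝ, 0 ≤ t → ω t ≤ ε * t + D := by
  obtain ⟨T, hT⟩ := eventually_atTop.1 (hωo.bound hε)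
  refine ⟨ω (max T 0), hω.nonneg (le_max_right _ _), fun t ht => ?_⟩
  rcases le_total T t with h | h
  · have h1 := hT t h
    rw [Real.norm_of_nonneg (hω.nonneg ht), Real.norm_of_nonneg ht] at h1
    have := hω.nonneg (le_max_right T 0)
    linarith
  · have := hω.le_of_le ht (h.trans (le_max_left _ 0))
    have : 0 ≤ ε * t := by positivity
    linarith

/-- Test the weight at t = kce, where ω(t) ≤ ρk + D because ω(t) = o(t), and use k! ≤ k^k. Thus
analytic bounds of any rate imply the bounds of every parameter ρ. -/
lemma exists_pow_mul_factorial_le (hω : IsWeightFunction ω) (hωo : ω =o[atTop] (fun t : ℝ => t))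
    {c ρ : ℝ} (hc : 0 < c) (hρ : 0 < ρ) :
    ∃ C : ℝ, 0 < C ∧ ∀ k : ℕ, c ^ k * k ! ≤ C * weightSeq ω ρ k := by
  set R := c * Real.exp 1 with hR
  have hR0 : 0 < R := by positivity
  obtain ⟨D, hD, h⟩ := hω.exists_le_mul_add hωo (show 0 < ρ / R by positivity)
  refine ⟨Real.exp (D / ρ) * Real.exp (ω 1 / ρ), by positivity, fun k => ?_⟩
  have h1 := hω.pow_mul_exp_le hρ (t := k * R) (by positivity) k
  have h2 : 0 ≤ D / ρ + -(ω (k * R) / ρ) + k := by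
    have := h (k * R) (by positivity)
    have e : D / ρ + -(ω (k * R) / ρ) + k = (ρ / R * (k * R) + D - ω (k * R)) / ρ := by
      field_simp; ring
    rw [e]
    exact div_nonneg (by linarith) hρ.le
  have h3 : (k ! : ℝ) ≤ (k : ℝ) ^ k := by exact_mod_cast Nat.factorial_le_pow k
  calc c ^ k * k ! ≤ c ^ k * (k : ℝ) ^ k * 1 := by rw [mul_one]; gcongr
    _ ≤ c ^ k * (k : ℝ) ^ k * (Real.exp (D / ρ) * Real.exp (-(ω (k * R) / ρ)) * Real.exp k) := by
        rw [← Real.exp_add, ← Real.exp_add]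
        exact mul_le_mul_of_nonneg_left (Real.one_le_exp h2) (by positivity)
    _ = Real.exp (D / ρ) * ((k * R) ^ k * Real.exp (-(ω (k * R) / ρ))) := by
        rw [hR, mul_pow, mul_pow, ← Real.exp_nat_mul, mul_one]; ring
    _ ≤ Real.exp (D / ρ) * (Real.exp (ω 1 / ρ) * weightSeq ω ρ k) := by gcongr
    _ = _ := by ring

/-- A substitute for the biconjugate formula, with a loss that doubling makes harmless. -/
lemma exists_weightSeq_le_pow (hω : IsWeightFunction ω) {ρ : ℝ} (hρ : 0 < ρ) {m : ℝ}
    (hm : 1 ≤ m) : ∃ k : ℕ, weightSeq ω ρ k ≤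
      m ^ k * (m * Real.exp (-(ω (m / Real.exp 1) / ρ))) := by
  have hm0 : 0 < m := one_pos.trans_le hm
  -- The slope of the secant of φ over [log m - 1, log m]. By convexity that secant lies below φ
  -- outside the interval; inside it, monotonicity suffices for `key`.
  set x := ω m - ω (m / Real.exp 1) with hx
  have hme : m / Real.exp 1 ≤ m := div_le_self hm0.le (Real.one_le_exp zero_le_one)
  have hx0 : 0 ≤ x := sub_nonneg.2 (hω.le_of_le (by positivity) hme)
  have e1 : m = Real.exp (Real.log m) := (Real.exp_log hm0).symm
  have e2 : m / Real.exp 1 = Real.exp (Real.log m - 1) := by rw [Real.exp_sub, Real.exp_log hm0]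
  have key : ∀ t : ℝ, 1 ≤ t →
      x * Real.log t - ω t ≤ x * Real.log m - ω (m / Real.exp 1) := by
    intro t ht
    have ht0 : 0 < t := one_pos.trans_le ht
    have e3 : t = Real.exp (Real.log t) := (Real.exp_log ht0).symm
    rcases lt_or_ge m t with h | h
    · have hlog : Real.log m < Real.log t := Real.log_lt_log hm0 h
      have h1 := hω.convex.slope_mono_adjacent (mem_univ (Real.log m - 1)) (mem_univ (Real.log t))
        (by linarith) hlog
      simp only [← e1, ← e2, ← e3] at h1
      rw [sub_sub_cancel, div_one, le_div_iff₀ (by linarith)] at h1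
      have : ω (m / Real.exp 1) ≤ ω m := by linarith
      rw [← hx] at h1
      linarith
    · have hlog : Real.log t ≤ Real.log m := Real.log_le_log ht0 h
      rcases le_or_gt (m / Real.exp 1) t with h' | h'
      · have := hω.le_of_le (by positivity) h'
        have := mul_le_mul_of_nonneg_left hlog hx0
        linarith
      · have hlog' : Real.log t < Real.log m - 1 := by
          rw [lt_sub_iff_add_lt, ← Real.exp_lt_exp, Real.exp_add, ← e3, ← e1]
          rwa [lt_div_iff₀ (Real.exp_pos 1)] at h'
        have h1 := hω.convex.slope_mono_adjacent (mem_univ (Real.log t)) (mem_univ (Real.log m))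
          hlog' (by linarith)
        simp only [← e1, ← e2, ← e3] at h1
        rw [sub_sub_cancel, div_one, div_le_iff₀ (by linarith), ← hx] at h1
        linarith
  -- The optimal exponent x/ρ must be rounded to an integer, which costs the extra factor m.
  refine ⟨⌊x / ρ⌋₊, weightSeq_le hρ (by positivity) fun t ht => ?_⟩
  set k := ⌊x / ρ⌋₊
  have ht0 : 0 < t := one_pos.trans_le ht
  have hk1 : (k : ℝ) ≤ x / ρ := Nat.floor_le (by positivity)
  have hk2 : x / ρ ≤ k + 1 := (Nat.lt_floor_add_one _).le
  rw [← mul_assoc, ← pow_succ, ← Real.exp_log (pow_pos ht0 k),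
    ← Real.exp_log (pow_pos hm0 (k + 1)), ← Real.exp_add, ← Real.exp_add]
  refine Real.exp_le_exp.2 ?_
  rw [Real.log_pow, Real.log_pow]
  have h1 := mul_le_mul_of_nonneg_right hk1 (Real.log_nonneg ht)
  have h2 := mul_le_mul_of_nonneg_right hk2 (Real.log_nonneg hm)
  have h3 : (x * Real.log t - ω t) / ρ ≤ (x * Real.log m - ω (m / Real.exp 1)) / ρ :=
    div_le_div_of_nonneg_right (key t ht) hρ.le
  have h4 : (x * Real.log t - ω t) / ρ = x / ρ * Real.log t - ω t / ρ := by ring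
  have h5 : (x * Real.log m - ω (m / Real.exp 1)) / ρ =
      x / ρ * Real.log m - ω (m / Real.exp 1) / ρ := by ring
  rw [h4, h5] at h3
  push_cast
  linarith

/-- Optimizing over k gives the decay m exp(-ω(m/e)/ρ). Doubling replaces ω(m/e) by ω(m)/L up to a
constant, and half of the resulting exponent absorbs m because log t = o(ω(t)); hence ε = 1/(2Lρ).
It will be applied to Fourier coefficients. -/
lemma exists_decay (hω : IsWeightFunction ω) {ρ : ℝ} (hρ : 0 < ρ) :
    ∃ ε : ℝ, 0 < ε ∧ ∃ D : ℝ, ∀ m : ℝ, 1 ≤ m → ∀ A c : ℝ, 0 ≤ A →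
      (∀ k : ℕ, c * m ^ k ≤ A * weightSeq ω ρ k) → c ≤ A * Real.exp (D - ε * ω m) := by
  obtain ⟨L, hL, D, hD, h⟩ := hω.exists_le_mul (Real.exp_pos 1).le
  have hL0 : 0 < L := one_pos.trans_le hL
  obtain ⟨D', hD', h'⟩ := hω.exists_mul_log_le (show 0 ≤ 2 * L * ρ by positivity)
  refine ⟨1 / (2 * L * ρ), by positivity, (D' + 2 * D) / (2 * L * ρ),
    fun m hm A c hA hc => ?_⟩
  have hm0 : 0 < m := one_pos.trans_le hm
  obtain ⟨k, hk⟩ := hω.exists_weightSeq_le_pow hρ hm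
  have h1 : c * m ^ k ≤ (A * (m * Real.exp (-(ω (m / Real.exp 1) / ρ)))) * m ^ k :=
    (hc k).trans ((mul_le_mul_of_nonneg_left hk hA).trans_eq (by ring))
  refine (le_of_mul_le_mul_right h1 (pow_pos hm0 k)).trans (mul_le_mul_of_nonneg_left ?_ hA)
  conv_lhs => rw [← Real.exp_log hm0, ← Real.exp_add, Real.exp_log hm0]
  refine Real.exp_le_exp.2 ?_
  have h2 := h (m / Real.exp 1) (by positivity)
  rw [mul_div_cancel₀ _ (Real.exp_pos 1).ne'] at h2
  have h3 := h' m hm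
  have e : (D' + 2 * D) / (2 * L * ρ) - 1 / (2 * L * ρ) * ω m -
      (Real.log m + -(ω (m / Real.exp 1) / ρ)) =
      ((ω m + D' - 2 * L * ρ * Real.log m) + 2 * (L * ω (m / Real.exp 1) + D - ω m)) /
        (2 * L * ρ) := by
    field_simp
    ring
  rw [← sub_nonneg, e]
  exact div_nonneg (by linarith) (by positivity)

end IsWeightFunction
end Ultradiff

namespace Ultradiff

/-! ### A strongly log-convex weight matrix from affine majorants -/

/-- The affine functions `s ↦ a + b s` with `a ≥ 0`, `b > 0` that dominate `ω` on `[0, ∞)`. -/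
def affineMajorants (ω : ℝ → ℝ) : Set (ℝ × ℝ) :=
  {p | 0 ≤ p.1 ∧ 0 < p.2 ∧ ∀ s : ℝ, 0 ≤ s → ω s ≤ p.1 + p.2 * s}

/-- The sequence `max (1, sup (ρ / b) ^ k exp (-a / ρ))`, the supremum being over the affine
majorants `a + b s` of `ω`. -/
noncomputable def majorantSeq (ω : ℝ → ℝ) (ρ : ℝ) (k : ℕ) : ℝ :=
  sSup (insert 1 ((fun p : ℝ × ℝ => (ρ / p.2) ^ k * Real.exp (-(p.1 / ρ))) '' affineMajorants ω))

/-- The weight matrix formed by the sequences `k!` times `majorantSeq ω ρ k`. -/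
def majorantMatrix (ω : ℝ → ℝ) : Set (ℕ → ℝ) :=
  {S | ∃ ρ : ℝ, 0 < ρ ∧ S = fun k => k ! * majorantSeq ω ρ k}

/-- Condition that `ω (l t) ≤ C l ω(t)` for all `l ≥ 1` and all large `t`. -/
def SublinearGrowth (ω : ℝ → ℝ) : Prop :=
  ∃ C : ℝ, 0 < C ∧ ∃ t₀ : ℝ, 0 < t₀ ∧ ∀ l : ℝ, 1 ≤ l → ∀ t : ℝ, t₀ ≤ t → ω (l * t) ≤ C * l * ω t

lemma root_tendsto_of_factorial_le {M : ℕ → ℝ} (h : ∀ k : ℕ, (k ! : ℝ) ≤ M k) :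
    Tendsto (fun k : ℕ => M k ^ (1 / (k : ℝ))) atTop atTop := by
  have h1 : Tendsto (fun k : ℕ => (k : ℝ) / Real.exp 1) atTop atTop :=
    tendsto_natCast_atTop_atTop.atTop_div_const (Real.exp_pos 1)
  refine tendsto_atTop_mono' _ ?_ h1
  filter_upwards [eventually_ge_atTop 1] with k hk
  have hk0 : (k : ℝ) ≠ 0 := by positivity
  have h2 : ((k : ℝ) / Real.exp 1) ^ k ≤ M k := by
    refine le_trans ?_ (h k)
    have := Real.pow_div_factorial_le_exp (k : ℝ) (by positivity) k
    rw [div_le_iff₀ (by positivity)] at this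
    rw [div_pow, div_le_iff₀ (by positivity), ← Real.exp_nat_mul, mul_one]
    linarith
  calc (k : ℝ) / Real.exp 1 = (((k : ℝ) / Real.exp 1) ^ k) ^ (1 / (k : ℝ)) := by
        rw [← Real.rpow_natCast, ← Real.rpow_mul (by positivity), mul_one_div_cancel hk0,
          Real.rpow_one]
    _ ≤ _ := Real.rpow_le_rpow (by positivity) h2 (by positivity)

namespace IsWeightFunction

variable {ω : ℝ → ℝ}

/-- Test the weight at t = kρ/b, where ω(t) ≤ a + kρ, and use k! ≤ k^k. -/
lemma factorial_mul_le_of_mem_affineMajorants (hω : IsWeightFunction ω) {ρ : ℝ} (hρ : 0 < ρ)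
    {p : ℝ × ℝ} (hp : p ∈ affineMajorants ω) (k : ℕ) :
    k ! * ((ρ / p.2) ^ k * Real.exp (-(p.1 / ρ))) ≤
      Real.exp (ω 1 / ρ) * (Real.exp 1 ^ k * weightSeq ω ρ k) := by
  obtain ⟨ha, hb, hab⟩ := hp
  have h1 := hω.pow_mul_exp_le hρ (t := k * (ρ / p.2)) (by positivity) k
  have h2 : Real.exp (-(p.1 / ρ)) ≤
      Real.exp 1 ^ k * Real.exp (-(ω (k * (ρ / p.2)) / ρ)) := by
    rw [← Real.exp_nat_mul, ← Real.exp_add]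
    refine Real.exp_le_exp.2 ?_
    have h3 := hab (k * (ρ / p.2)) (by positivity)
    have e : (k : ℝ) * 1 + -(ω (k * (ρ / p.2)) / ρ) - -(p.1 / ρ) =
        (p.1 + p.2 * (k * (ρ / p.2)) - ω (k * (ρ / p.2))) / ρ := by field_simp; ring
    rw [← sub_nonneg, e]
    exact div_nonneg (by linarith) hρ.le
  have h3 : (k ! : ℝ) ≤ (k : ℝ) ^ k := by exact_mod_cast Nat.factorial_le_pow k
  calc k ! * ((ρ / p.2) ^ k * Real.exp (-(p.1 / ρ)))
      ≤ (k : ℝ) ^ k * ((ρ / p.2) ^ k *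
        (Real.exp 1 ^ k * Real.exp (-(ω (k * (ρ / p.2)) / ρ)))) := by gcongr
    _ = Real.exp 1 ^ k * ((k * (ρ / p.2)) ^ k * Real.exp (-(ω (k * (ρ / p.2)) / ρ))) := by
        rw [mul_pow]; ring
    _ ≤ Real.exp 1 ^ k * (Real.exp (ω 1 / ρ) * weightSeq ω ρ k) := by gcongr
    _ = _ := by ring

lemma bddAbove_majorantSeq (hω : IsWeightFunction ω) {ρ : ℝ} (hρ : 0 < ρ) (k : ℕ) :
    BddAbove (insert 1
      ((fun p : ℝ × ℝ => (ρ / p.2) ^ k * Real.exp (-(p.1 / ρ))) '' affineMajorants ω)) := by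
  refine BddAbove.insert _
    ⟨Real.exp (ω 1 / ρ) * (Real.exp 1 ^ k * weightSeq ω ρ k) / k !, ?_⟩
  rintro _ ⟨p, hp, rfl⟩
  rw [le_div_iff₀ (by positivity), mul_comm]
  exact hω.factorial_mul_le_of_mem_affineMajorants hρ hp k

/-- The purpose of the inserted 1: it yields k! ≤ M_k for the matrix, and M_0 = 1. -/
lemma one_le_majorantSeq (hω : IsWeightFunction ω) {ρ : ℝ} (hρ : 0 < ρ) (k : ℕ) :
    1 ≤ majorantSeq ω ρ k :=
  le_csSup (hω.bddAbove_majorantSeq hρ k) (mem_insert _ _)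

lemma le_majorantSeq (hω : IsWeightFunction ω) {ρ : ℝ} (hρ : 0 < ρ) (k : ℕ) {p : ℝ × ℝ}
    (hp : p ∈ affineMajorants ω) :
    (ρ / p.2) ^ k * Real.exp (-(p.1 / ρ)) ≤ majorantSeq ω ρ k :=
  le_csSup (hω.bddAbove_majorantSeq hρ k) (mem_insert_of_mem _ ⟨p, hp, rfl⟩)

lemma majorantSeq_le {ρ : ℝ} {k : ℕ} {B : ℝ} (h1 : 1 ≤ B)
    (h : ∀ p ∈ affineMajorants ω, (ρ / p.2) ^ k * Real.exp (-(p.1 / ρ)) ≤ B) :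
    majorantSeq ω ρ k ≤ B := by
  refine csSup_le (insert_nonempty _ _) ?_
  rintro _ (rfl | ⟨p, hp, rfl⟩)
  · exact h1
  · exact h p hp

lemma majorantSeq_zero (hω : IsWeightFunction ω) {ρ : ℝ} (hρ : 0 < ρ) :
    majorantSeq ω ρ 0 = 1 := by
  refine le_antisymm (majorantSeq_le le_rfl fun p hp => ?_) (hω.one_le_majorantSeq hρ 0)
  rw [pow_zero, one_mul, Real.exp_le_one_iff, neg_nonpos]
  exact div_nonneg hp.1 hρ.le

lemma majorantSeq_mono (hω : IsWeightFunction ω) {ρ ρ' : ℝ} (hρ : 0 < ρ) (h : ρ ≤ ρ') (k : ℕ) :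
    majorantSeq ω ρ k ≤ majorantSeq ω ρ' k := by
  have hρ' := hρ.trans_le h
  refine majorantSeq_le (hω.one_le_majorantSeq hρ' k) fun p hp =>
    le_trans ?_ (hω.le_majorantSeq hρ' k hp)
  obtain ⟨ha, hb, -⟩ := hp
  gcongr

/-- For a fixed majorant the terms are geometric in k, as is the constant 1, and log-convexity
passes to suprema. -/
lemma logConvexSeq_majorantSeq (hω : IsWeightFunction ω) {ρ : ℝ} (hρ : 0 < ρ) :
    LogConvexSeq (majorantSeq ω ρ) := by
  intro k
  have h0 := hω.one_le_majorantSeq hρ k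
  have h2 := hω.one_le_majorantSeq hρ (k + 2)
  have h1 := hω.one_le_majorantSeq hρ (k + 1)
  have hP : 0 ≤ majorantSeq ω ρ k * majorantSeq ω ρ (k + 2) := by positivity
  have : majorantSeq ω ρ (k + 1) ≤ √(majorantSeq ω ρ k * majorantSeq ω ρ (k + 2)) := by
    refine majorantSeq_le ?_ fun p hp => ?_
    · rw [Real.one_le_sqrt]
      exact one_le_mul_of_one_le_of_one_le h0 h2
    · have hb := hp.2.1
      refine Real.le_sqrt_of_sq_le ?_
      calc ((ρ / p.2) ^ (k + 1) * Real.exp (-(p.1 / ρ))) ^ 2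
          = ((ρ / p.2) ^ k * Real.exp (-(p.1 / ρ))) *
            ((ρ / p.2) ^ (k + 2) * Real.exp (-(p.1 / ρ))) := by ring
        _ ≤ _ := mul_le_mul (hω.le_majorantSeq hρ k hp) (hω.le_majorantSeq hρ (k + 2) hp)
            (by positivity) (by positivity)
  calc majorantSeq ω ρ (k + 1) ^ 2 ≤ √(majorantSeq ω ρ k * majorantSeq ω ρ (k + 2)) ^ 2 := by
        gcongr
    _ = _ := Real.sq_sqrt hP

lemma isWeightMatrix_majorantMatrix (hω : IsWeightFunction ω) :
    IsWeightMatrix (majorantMatrix ω) where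
  nonempty := ⟨_, 1, one_pos, rfl⟩
  factorial_le := by
    rintro _ ⟨ρ, hρ, rfl⟩ k
    exact le_mul_of_one_le_right (by positivity) (hω.one_le_majorantSeq hρ k)
  weightSequence := by
    rintro _ ⟨ρ, hρ, rfl⟩
    have h1 := hω.one_le_majorantSeq hρ
    refine ⟨fun k => ?_, ?_, root_tendsto_of_factorial_le fun k => ?_, fun k => ?_⟩
    · have := h1 k
      positivity
    · simp [hω.majorantSeq_zero hρ]
    · exact le_mul_of_one_le_right (by positivity) (h1 k)
    · have h2 := hω.logConvexSeq_majorantSeq hρ k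
      have h3 : ((k + 1)! : ℝ) ^ 2 ≤ k ! * (k + 2)! := by
        have : (k + 1)! ^ 2 ≤ k ! * (k + 2)! := by
          rw [Nat.factorial_succ (k + 1), Nat.factorial_succ k]
          nlinarith [Nat.factorial_pos k, sq_nonneg (k !), Nat.zero_le (k * k ! ^ 2)]
        exact_mod_cast this
      have h0 : 0 ≤ majorantSeq ω ρ k := zero_le_one.trans (h1 k)
      calc (((k + 1)! : ℝ) * majorantSeq ω ρ (k + 1)) ^ 2
          = ((k + 1)! : ℝ) ^ 2 * majorantSeq ω ρ (k + 1) ^ 2 := by ring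
        _ ≤ (k ! * (k + 2)!) * (majorantSeq ω ρ k * majorantSeq ω ρ (k + 2)) := by gcongr
        _ = _ := by ring
  total := by
    rintro _ ⟨ρ, hρ, rfl⟩ _ ⟨ρ', hρ', rfl⟩
    rcases le_total ρ ρ' with h | h
    · exact Or.inl fun k => mul_le_mul_of_nonneg_left (hω.majorantSeq_mono hρ h k) (by positivity)
    · exact Or.inr fun k => mul_le_mul_of_nonneg_left (hω.majorantSeq_mono hρ' h k) (by positivity)

lemma stronglyLogConvex_of_mem_majorantMatrix (hω : IsWeightFunction ω) :
    ∀ S ∈ majorantMatrix ω, StronglyLogConvex S := by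
  rintro _ ⟨ρ, hρ, rfl⟩
  have : (fun k : ℕ => (k ! * majorantSeq ω ρ k) / (k ! : ℝ)) = majorantSeq ω ρ := by
    funext k
    field_simp
  rw [StronglyLogConvex, this]
  exact hω.logConvexSeq_majorantSeq hρ

/-- The affine majorants are covered by `factorial_mul_le_of_mem_affineMajorants`; the inserted 1
needs k! itself to be dominated, which is where ω(t) = o(t) enters. -/
lemma exists_factorial_mul_majorantSeq_le (hω : IsWeightFunction ω)
    (hωo : ω =o[atTop] (fun t : ℝ => t)) {ρ : ℝ} (hρ : 0 < ρ) :
    ∃ C : ℝ, 0 < C ∧ ∀ k : ℕ, k ! * majorantSeq ω ρ k ≤ C * (Real.exp 1 ^ k * weightSeq ω ρ k) := by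
  obtain ⟨C, hC, h⟩ := hω.exists_pow_mul_factorial_le hωo one_pos hρ
  refine ⟨max C (Real.exp (ω 1 / ρ)), lt_max_of_lt_left hC, fun k => ?_⟩
  have hW := weightSeq_pos ω ρ k
  have he : 1 ≤ Real.exp 1 ^ k := one_le_pow₀ (Real.one_le_exp zero_le_one)
  rw [mul_comm, ← le_div_iff₀ (by positivity)]
  refine majorantSeq_le ?_ fun p hp => ?_
  · rw [one_le_div (by positivity)]
    have := h k
    rw [one_pow, one_mul] at this
    refine this.trans ?_
    gcongr
    · exact le_max_left _ _
    · exact le_mul_of_one_le_left hW.le he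
  · rw [le_div_iff₀ (by positivity), mul_comm]
    refine (hω.factorial_mul_le_of_mem_affineMajorants hρ hp k).trans ?_
    gcongr
    exact le_max_right _ _

/-- For s ≤ t the constant term suffices by monotonicity; for s ≥ t the growth condition with factor
s/t makes the linear term suffice. Both consequences of (b) use it only through these majorants,
whose value at t is (1 + C) ω(t). -/
lemma exists_mem_affineMajorants (hω : IsWeightFunction ω) (hb : SublinearGrowth ω) :
    ∃ C : ℝ, 0 < C ∧ ∃ T : ℝ, 1 ≤ T ∧ ∀ t : ℝ, T ≤ t →
      0 < ω t ∧ ((ω t, C * ω t / t) : ℝ × ℝ) ∈ affineMajorants ω := by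
  obtain ⟨C, hC, t₀, ht₀, h⟩ := hb
  obtain ⟨t₁, ht₁⟩ := eventually_atTop.1 (hω.tendsto.eventually_gt_atTop 0)
  refine ⟨C, hC, max (max t₀ t₁) 1, le_max_right _ _, fun t htT => ?_⟩
  have ht0 : 0 < t := one_pos.trans_le ((le_max_right _ _).trans htT)
  have hx0 : 0 < ω t := ht₁ t ((le_max_right _ _).trans ((le_max_left _ _).trans htT))
  have htt₀ : t₀ ≤ t := (le_max_left _ _).trans ((le_max_left _ _).trans htT)
  refine ⟨hx0, hx0.le, by positivity, fun s hs => ?_⟩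
  simp only
  rcases le_total s t with hst | hst
  · have := hω.le_of_le hs hst
    have : 0 ≤ C * ω t / t * s := by positivity
    linarith
  · have := h (s / t) ((one_le_div ht0).2 hst) t htt₀
    rw [div_mul_cancel₀ _ ht0.ne'] at this
    have e : C * ω t / t * s = C * (s / t) * ω t := by ring
    linarith

/-- Write exp(-ω(t)/ρ) as a square. One factor is exp(-a/(2ρ)) for the majorant attached to t; the
other turns ω(t)^k into k! (2ρ)^k through x^k ≤ k! exp x with x = ω(t)/(2ρ). This is why the
parameter doubles. For small t the power t^k is merely geometric. -/
lemma exists_weightSeq_le_majorantSeq (hω : IsWeightFunction ω) (hb : SublinearGrowth ω) :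
    ∃ c : ℝ, 0 < c ∧ ∀ ρ : ℝ, 0 < ρ → ∀ k : ℕ,
      weightSeq ω ρ k ≤ c ^ k * (k ! * majorantSeq ω (2 * ρ) k) := by
  obtain ⟨C, hC, T, hT1, h⟩ := hω.exists_mem_affineMajorants hb
  have hcT : T ≤ max C T := le_max_right _ _
  have hc0 : 0 < max C T := hC.trans_le (le_max_left _ _)
  refine ⟨max C T, hc0, fun ρ hρ k => ?_⟩
  have h2ρ : 0 < 2 * ρ := by positivity
  have hs1 := hω.one_le_majorantSeq h2ρ k
  have hf : (1 : ℝ) ≤ k ! := by exact_mod_cast Nat.one_le_iff_ne_zero.2 (Nat.factorial_ne_zero k)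
  refine weightSeq_le hρ (by positivity) fun t ht => ?_
  have ht0 : 0 < t := one_pos.trans_le ht
  rcases le_total t T with htT | htT
  · have h1 : Real.exp (-(ω t / ρ)) ≤ 1 :=
      Real.exp_le_one_iff.2 (neg_nonpos.2 (div_nonneg (hω.nonneg ht0.le) hρ.le))
    calc t ^ k * Real.exp (-(ω t / ρ)) ≤ (max C T) ^ k * 1 := by
          gcongr
          exact htT.trans hcT
      _ ≤ _ := by
          gcongr
          exact one_le_mul_of_one_le_of_one_le hf hs1
  · obtain ⟨hx0, hp⟩ := h t htT
    have h1 := hω.le_majorantSeq h2ρ k hp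
    simp only at h1
    have h2 := Real.pow_div_factorial_le_exp (ω t / (2 * ρ)) (by positivity) k
    rw [div_le_iff₀ (by positivity), div_pow, div_le_iff₀ (by positivity)] at h2
    have e1 : Real.exp (-(ω t / ρ)) =
        Real.exp (-(ω t / (2 * ρ))) * Real.exp (-(ω t / (2 * ρ))) := by
      rw [← Real.exp_add]
      congr 1
      field_simp
      ring
    have e2 : Real.exp (ω t / (2 * ρ)) * Real.exp (-(ω t / (2 * ρ))) = 1 := by
      rw [← Real.exp_add]; simp
    calc t ^ k * Real.exp (-(ω t / ρ))
        = (t / ω t) ^ k * Real.exp (-(ω t / (2 * ρ))) *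
          ((ω t) ^ k * Real.exp (-(ω t / (2 * ρ)))) := by
          rw [e1, div_pow]; field_simp
      _ ≤ (t / ω t) ^ k * Real.exp (-(ω t / (2 * ρ))) *
          (Real.exp (ω t / (2 * ρ)) * k ! * (2 * ρ) ^ k * Real.exp (-(ω t / (2 * ρ)))) := by
          gcongr
      _ = (Real.exp (ω t / (2 * ρ)) * Real.exp (-(ω t / (2 * ρ)))) * C ^ k *
          (k ! * ((2 * ρ / (C * ω t / t)) ^ k * Real.exp (-(ω t / (2 * ρ))))) := by
          rw [div_pow, div_pow, div_pow, mul_pow C]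
          field_simp
      _ ≤ 1 * (max C T) ^ k * (k ! * majorantSeq ω (2 * ρ) k) := by
          rw [e2]
          gcongr
          exact le_max_left _ _
      _ = _ := by rw [one_mul]

/-! ### The weight function and the majorant matrix define the same classes. -/

theorem sameClass_roumieu_majorantMatrix (hω : IsWeightFunction ω)
    (hωo : ω =o[atTop] (fun t : ℝ => t)) (hb : SublinearGrowth ω) :
    SameClass (roumieuWeight ω) (roumieuMatrix (majorantMatrix ω)) := by
  intro n U _
  obtain ⟨c, hc, hcW⟩ := hω.exists_weightSeq_le_majorantSeq hb
  ext f
  constructor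
  · rintro ⟨hf, ρ, hρ, hb⟩
    exact ⟨hf, _, ⟨2 * ρ, by positivity, rfl⟩, c, hc, hb.mono (A := 1)
      (fun k => (weightSeq_pos ω ρ k).le) (fun k => by rw [one_mul]; exact hcW ρ hρ k)⟩
  · rintro ⟨hf, _, ⟨ρ, hρ, rfl⟩, r, hr, hb⟩
    obtain ⟨L, hL, h⟩ := hω.exists_pow_mul_weightSeq_le (show 0 ≤ r * Real.exp 1 by positivity)
    obtain ⟨C, hC, hCW⟩ := h ρ hρ
    obtain ⟨C', hC', hS⟩ := hω.exists_factorial_mul_majorantSeq_le hωo hρ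
    refine ⟨hf, L * ρ, by positivity, hb.mono (A := C' * C) (fun k => ?_) (fun k => ?_)⟩
    · have := hω.one_le_majorantSeq hρ k
      positivity
    · calc r ^ k * (k ! * majorantSeq ω ρ k)
          ≤ r ^ k * (C' * (Real.exp 1 ^ k * weightSeq ω ρ k)) :=
            mul_le_mul_of_nonneg_left (hS k) (by positivity)
        _ = C' * ((r * Real.exp 1) ^ k * weightSeq ω ρ k) := by rw [mul_pow]; ring
        _ ≤ C' * (C * weightSeq ω (L * ρ) k) :=
            mul_le_mul_of_nonneg_left (hCW k) hC'.le
        _ = _ := by rw [mul_assoc]; rfl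

theorem sameClass_beurling_majorantMatrix (hω : IsWeightFunction ω)
    (hωo : ω =o[atTop] (fun t : ℝ => t)) (hb : SublinearGrowth ω) :
    SameClass (beurlingWeight ω) (beurlingMatrix (majorantMatrix ω)) := by
  intro n U _
  obtain ⟨c, hc, hcW⟩ := hω.exists_weightSeq_le_majorantSeq hb
  ext f
  constructor
  · rintro ⟨hf, hb⟩
    refine ⟨hf, ?_⟩
    rintro _ ⟨ρ, hρ, rfl⟩ r hr
    obtain ⟨L, hL, h⟩ := hω.exists_pow_mul_weightSeq_le (show 0 ≤ c / r by positivity)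
    have hL0 : 0 < L := one_pos.trans_le hL
    -- Of the divisor 2L, the factor L pays for absorbing (c/r)^k and the factor 2 for passing to
    -- the majorant sequence.
    obtain ⟨C, hC, hCW⟩ := h (ρ / (2 * L)) (by positivity)
    have e : 2 * (L * (ρ / (2 * L))) = ρ := by field_simp
    refine (hb (ρ / (2 * L)) (by positivity)).mono (A := C)
      (fun k => (weightSeq_pos ω _ k).le) (fun k => ?_)
    have h1 := hcW (L * (ρ / (2 * L))) (by positivity) k
    rw [e] at h1
    have h2 := hCW k
    rw [div_pow, div_mul_eq_mul_div, div_le_iff₀ (by positivity)] at h2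
    have h3 : c ^ k * weightSeq ω (ρ / (2 * L)) k ≤
        c ^ k * (C * (r ^ k * (k ! * majorantSeq ω ρ k))) := by
      calc _ ≤ C * weightSeq ω (L * (ρ / (2 * L))) k * r ^ k := h2
        _ ≤ C * (c ^ k * (k ! * majorantSeq ω ρ k)) * r ^ k := by gcongr
        _ = _ := by ring
    exact le_of_mul_le_mul_left h3 (by positivity)
  · rintro ⟨hf, hb⟩
    refine ⟨hf, fun ρ hρ => ?_⟩
    obtain ⟨C, hC, hS⟩ := hω.exists_factorial_mul_majorantSeq_le hωo hρ
    -- The rate 1/e cancels the factor e^k in the bound for the majorant sequence.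
    refine (hb _ ⟨ρ, hρ, rfl⟩ (Real.exp 1)⁻¹ (by positivity)).mono (A := C) (fun k => ?_)
      (fun k => ?_)
    · have := hω.one_le_majorantSeq hρ k
      positivity
    · rw [inv_pow, inv_mul_le_iff₀ (by positivity)]
      refine (hS k).trans_eq ?_
      change _ = Real.exp 1 ^ k * (C * weightSeq ω ρ k)
      ring

end IsWeightFunction

lemma rGood_of_stronglyLogConvex {ω : ℝ → ℝ} {𝔖 : Set (ℕ → ℝ)} (h𝔖 : IsWeightMatrix 𝔖)
    (hS : ∀ S ∈ 𝔖, StronglyLogConvex S) (h : SameClass (roumieuWeight ω) (roumieuMatrix 𝔖)) :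
    RGood ω :=
  ⟨𝔖, h𝔖, fun S hS' => ⟨S, hS', .of_stronglyLogConvex (hS S hS') (h𝔖.weightSequence S hS').pos⟩, h⟩

lemma bGood_of_stronglyLogConvex {ω : ℝ → ℝ} {𝔖 : Set (ℕ → ℝ)} (h𝔖 : IsWeightMatrix 𝔖)
    (hS : ∀ S ∈ 𝔖, StronglyLogConvex S) (h : SameClass (beurlingWeight ω) (beurlingMatrix 𝔖)) :
    BGood ω :=
  ⟨𝔖, h𝔖, fun S hS' => ⟨S, hS', .of_stronglyLogConvex (hS S hS') (h𝔖.weightSequence S hS').pos⟩, h⟩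

end Ultradiff

lemma ConcaveOn.map_mul_le {σ : ℝ → ℝ} (hσ : ConcaveOn ℝ (Ici 0) σ) (h0 : σ 0 = 0) {l t : ℝ}
    (hl : 1 ≤ l) (ht : 0 ≤ t) : σ (l * t) ≤ l * σ t := by
  have hl0 : 0 < l := one_pos.trans_le hl
  have h : l⁻¹ • σ (l * t) + (1 - l⁻¹) • σ 0 ≤ σ (l⁻¹ • (l * t) + (1 - l⁻¹) • 0) :=
    hσ.2 (mem_Ici.2 (by positivity)) (mem_Ici.2 le_rfl) (by positivity)
      (sub_nonneg.2 (inv_le_one_of_one_le₀ hl)) (by ring)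
  simp only [smul_eq_mul, mul_zero, add_zero, h0, inv_mul_cancel_left₀ hl0.ne'] at h
  rwa [inv_mul_le_iff₀ hl0] at h

namespace Ultradiff

/-! ### The least concave majorant -/

/-- The graph of `ω` over `[0, ∞)`. -/
def weightGraph (ω : ℝ → ℝ) : Set (ℝ × ℝ) := (fun s => (s, ω s)) '' Ici 0

/-- The least concave majorant of `ω` on `[0, ∞)`. -/
noncomputable def concaveMajorant (ω : ℝ → ℝ) (t : ℝ) : ℝ :=
  sSup {y | (t, y) ∈ convexHull ℝ (weightGraph ω)}

lemma le_of_mem_convexHull_weightGraph {ω : ℝ → ℝ} {t y : ℝ}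
    (h : (t, y) ∈ convexHull ℝ (weightGraph ω)) {p : ℝ × ℝ} (hp : p ∈ affineMajorants ω) :
    y ≤ p.1 + p.2 * t := by
  have hconv : Convex ℝ {q : ℝ × ℝ | q.2 ≤ p.1 + p.2 * q.1} := by
    intro q hq r hr a b ha hb hab
    simp only [mem_ofPred_eq, Prod.snd_add, Prod.smul_snd, smul_eq_mul, Prod.fst_add,
      Prod.smul_fst] at *
    have h1 := mul_le_mul_of_nonneg_left hq ha
    have h2 := mul_le_mul_of_nonneg_left hr hb
    have e : p.1 = a * p.1 + b * p.1 := by rw [← add_mul, hab, one_mul]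
    rw [e]
    linarith
  have hsub : weightGraph ω ⊆ {q : ℝ × ℝ | q.2 ≤ p.1 + p.2 * q.1} := by
    rintro _ ⟨s, hs, rfl⟩
    exact hp.2.2 s hs
  exact convexHull_min hsub hconv h

namespace IsWeightFunction

variable {ω : ℝ → ℝ}

/-- Continuity at 0 handles small s, and a steep slope handles the rest. Arbitrarily small
intercepts make the concave majorant vanish and be continuous at 0. -/
lemma exists_mem_affineMajorants_of_pos (hω : IsWeightFunction ω)
    (hωo : ω =o[atTop] (fun t : ℝ => t)) {ε : ℝ} (hε : 0 < ε) :
    ∃ b : ℝ, (ε, b) ∈ affineMajorants ω := by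
  obtain ⟨D, hD, h⟩ := hω.exists_le_mul_add hωo one_pos
  have h0 : ContinuousWithinAt ω (Ici 0) 0 := hω.cont 0 (mem_Ici.2 le_rfl)
  obtain ⟨δ, hδ, hδ'⟩ := Metric.continuousWithinAt_iff.1 h0 ε hε
  refine ⟨1 + D / δ, hε.le, by positivity, fun s hs => ?_⟩
  simp only
  have hb : 0 ≤ (1 + D / δ) * s := by positivity
  rcases lt_or_ge s δ with hsδ | hsδ
  · have := hδ' (mem_Ici.2 hs) (by rwa [Real.dist_eq, sub_zero, abs_of_nonneg hs])
    rw [hω.map_zero, Real.dist_eq, sub_zero] at this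
    have := (le_abs_self _).trans this.le
    linarith
  · have h1 := h s hs
    have h2 : D ≤ D / δ * s := by
      rw [div_mul_eq_mul_div, le_div_iff₀ hδ]
      gcongr
    linarith

lemma bddAbove_concaveMajorant (hω : IsWeightFunction ω) (hωo : ω =o[atTop] (fun t : ℝ => t))
    (t : ℝ) : BddAbove {y | (t, y) ∈ convexHull ℝ (weightGraph ω)} := by
  obtain ⟨b, hb⟩ := hω.exists_mem_affineMajorants_of_pos hωo one_pos
  exact ⟨1 + b * t, fun y hy => le_of_mem_convexHull_weightGraph hy hb⟩

lemma le_concaveMajorant_of_mem (hω : IsWeightFunction ω) (hωo : ω =o[atTop] (fun t : ℝ => t))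
    {t y : ℝ} (h : (t, y) ∈ convexHull ℝ (weightGraph ω)) : y ≤ concaveMajorant ω t :=
  le_csSup (hω.bddAbove_concaveMajorant hωo t) h

lemma mem_convexHull_weightGraph {t : ℝ} (ht : 0 ≤ t) :
    (t, ω t) ∈ convexHull ℝ (weightGraph ω) :=
  subset_convexHull ℝ _ ⟨t, ht, rfl⟩

lemma le_concaveMajorant (hω : IsWeightFunction ω) (hωo : ω =o[atTop] (fun t : ℝ => t))
    {t : ℝ} (ht : 0 ≤ t) : ω t ≤ concaveMajorant ω t :=
  hω.le_concaveMajorant_of_mem hωo (mem_convexHull_weightGraph ht)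

lemma concaveMajorant_le {t B : ℝ} (ht : 0 ≤ t)
    (h : ∀ y, (t, y) ∈ convexHull ℝ (weightGraph ω) → y ≤ B) : concaveMajorant ω t ≤ B :=
  csSup_le ⟨_, mem_convexHull_weightGraph ht⟩ h

lemma concaveMajorant_le_of_mem {t : ℝ} (ht : 0 ≤ t) {p : ℝ × ℝ} (hp : p ∈ affineMajorants ω) :
    concaveMajorant ω t ≤ p.1 + p.2 * t :=
  concaveMajorant_le ht fun _ hy => le_of_mem_convexHull_weightGraph hy hp

lemma concaveMajorant_zero (hω : IsWeightFunction ω) (hωo : ω =o[atTop] (fun t : ℝ => t)) :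
    concaveMajorant ω 0 = 0 := by
  refine le_antisymm (le_of_forall_pos_le_add fun ε hε => ?_) ?_
  · obtain ⟨b, hb⟩ := hω.exists_mem_affineMajorants_of_pos hωo hε
    simpa using concaveMajorant_le_of_mem le_rfl hb
  · simpa [hω.map_zero] using hω.le_concaveMajorant hωo le_rfl

lemma concaveOn_concaveMajorant (hω : IsWeightFunction ω) (hωo : ω =o[atTop] (fun t : ℝ => t)) :
    ConcaveOn ℝ (Ici 0) (concaveMajorant ω) := by
  refine ⟨convex_Ici 0, fun s hs t ht a b ha hb hab => ?_⟩
  refine le_of_forall_pos_le_add fun ε hε => ?_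
  obtain ⟨y, hy, hy'⟩ := exists_lt_of_lt_csSup
    (s := {y | (s, y) ∈ convexHull ℝ (weightGraph ω)}) ⟨_, mem_convexHull_weightGraph hs⟩
    (show concaveMajorant ω s - ε < concaveMajorant ω s by linarith)
  obtain ⟨z, hz, hz'⟩ := exists_lt_of_lt_csSup
    (s := {y | (t, y) ∈ convexHull ℝ (weightGraph ω)}) ⟨_, mem_convexHull_weightGraph ht⟩
    (show concaveMajorant ω t - ε < concaveMajorant ω t by linarith)
  have h1 := hω.le_concaveMajorant_of_mem hωo (t := a • s + b • t) (y := a • y + b • z)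
    (convex_convexHull ℝ _ hy hz ha hb hab)
  simp only [smul_eq_mul] at *
  have h2 := mul_le_mul_of_nonneg_left hy'.le ha
  have h3 := mul_le_mul_of_nonneg_left hz'.le hb
  have e : ε = a * ε + b * ε := by rw [← add_mul, hab, one_mul]
  linarith

/-- Every point of the convex hull of the graph lies on a curve `(exp x, ψ x)` in the hull with
`ψ` convex and increasing. -/
lemma exists_convexOn_of_mem (hω : IsWeightFunction ω) {t y : ℝ} (ht : 0 < t)
    (h : (t, y) ∈ convexHull ℝ (weightGraph ω)) : ∃ ψ : ℝ → ℝ, ConvexOn ℝ univ ψ ∧ Monotone ψ ∧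
      ψ (Real.log t) = y ∧ ∀ x, (Real.exp x, ψ x) ∈ convexHull ℝ (weightGraph ω) := by
  obtain ⟨ι, _, w, z, hw, hw1, hz, hsum⟩ := mem_convexHull_iff_exists_fintype.1 h
  have hz0 : ∀ i, 0 ≤ (z i).1 := by
    intro i
    obtain ⟨s, hs, hsz⟩ := hz i
    rw [← hsz]
    exact hs
  have hz1 : ∀ i, (z i).2 = ω (z i).1 := by
    intro i
    obtain ⟨s, hs, hsz⟩ := hz i
    rw [← hsz]
  have hu0 : ∀ i, 0 ≤ (z i).1 / t := fun i => div_nonneg (hz0 i) ht.le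
  have hs1 : ∑ i, w i * (z i).1 = t := by
    simpa [Prod.fst_sum] using congrArg Prod.fst hsum
  have hs2 : ∑ i, w i * (z i).2 = y := by
    simpa [Prod.snd_sum] using congrArg Prod.snd hsum
  have hterm : ∀ u : ℝ, 0 ≤ u → ConvexOn ℝ univ (fun x => ω (Real.exp x * u)) := by
    intro u hu
    rcases hu.eq_or_lt with rfl | hu
    · simpa using convexOn_const (ω 0) convex_univ
    · refine ⟨convex_univ, fun x _ x' _ a b ha hb hab => ?_⟩
      have h1 := hω.convex.2 (mem_univ (x + Real.log u)) (mem_univ (x' + Real.log u)) ha hb hab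
      have e : a • (x + Real.log u) + b • (x' + Real.log u) =
          a • x + b • x' + Real.log u := by
        simp only [smul_eq_mul]
        linear_combination Real.log u * hab
      rw [e] at h1
      simpa only [Real.exp_add _ (Real.log u), Real.exp_log hu] using h1
  -- Keep the weights of the convex combination and scale all abscissas by exp(x)/t. Each summand is
  -- then a constant or a nonnegative multiple of a translate of φ.
  refine ⟨fun x => ∑ i, w i * ω (Real.exp x * ((z i).1 / t)),
    ⟨convex_univ, fun x _ x' _ a b ha hb hab => ?_⟩, fun x x' hxx' => ?_, ?_, fun x => ?_⟩
  · simp only [smul_eq_mul, Finset.mul_sum]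
    rw [← Finset.sum_add_distrib]
    refine Finset.sum_le_sum fun i _ => ?_
    have := mul_le_mul_of_nonneg_left
      ((hterm _ (hu0 i)).2 (mem_univ x) (mem_univ x') ha hb hab) (hw i)
    simp only [smul_eq_mul] at this
    linarith
  · refine Finset.sum_le_sum fun i _ => mul_le_mul_of_nonneg_left (hω.le_of_le ?_ ?_) (hw i)
    · exact mul_nonneg (Real.exp_pos _).le (hu0 i)
    · exact mul_le_mul_of_nonneg_right (Real.exp_le_exp.2 hxx') (hu0 i)
  · rw [← hs2]
    refine Finset.sum_congr rfl fun i _ => ?_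
    rw [Real.exp_log ht, mul_div_cancel₀ _ ht.ne', hz1]
  · refine mem_convexHull_iff_exists_fintype.2 ⟨ι, inferInstance, w,
      fun i => (Real.exp x * ((z i).1 / t), ω (Real.exp x * ((z i).1 / t))), hw, hw1,
      fun i => ⟨_, mul_nonneg (Real.exp_pos _).le (hu0 i), rfl⟩, ?_⟩
    ext
    · have : ∑ i, w i * (Real.exp x * ((z i).1 / t)) = Real.exp x / t * ∑ i, w i * (z i).1 := by
        rw [Finset.mul_sum]
        exact Finset.sum_congr rfl fun i _ => by ring
      simp only [Prod.fst_sum, Prod.smul_fst, smul_eq_mul]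
      rw [this, hs1, div_mul_cancel₀ _ ht.ne']
    · simp [Prod.snd_sum]

/-- In the coordinate log t, each hull point lies on a convex curve staying below the majorant, so
the majorant is a supremum of convex functions. -/
lemma convexOn_concaveMajorant_exp (hω : IsWeightFunction ω)
    (hωo : ω =o[atTop] (fun t : ℝ => t)) :
    ConvexOn ℝ univ (fun y : ℝ => concaveMajorant ω (Real.exp y)) := by
  refine ⟨convex_univ, fun x _ x' _ a b ha hb hab => ?_⟩
  refine concaveMajorant_le (Real.exp_pos _).le fun y hy => ?_
  obtain ⟨ψ, hψ, -, hψy, hψmem⟩ := hω.exists_convexOn_of_mem (Real.exp_pos _) hy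
  rw [Real.log_exp] at hψy
  rw [← hψy]
  refine (hψ.2 (mem_univ x) (mem_univ x') ha hb hab).trans ?_
  have h1 := hω.le_concaveMajorant_of_mem hωo (hψmem x)
  have h2 := hω.le_concaveMajorant_of_mem hωo (hψmem x')
  simp only [smul_eq_mul]
  gcongr

lemma monotoneOn_concaveMajorant (hω : IsWeightFunction ω)
    (hωo : ω =o[atTop] (fun t : ℝ => t)) : MonotoneOn (concaveMajorant ω) (Ici 0) := by
  intro s hs t ht hst
  rcases (mem_Ici.1 hs).eq_or_lt with rfl | hs0
  · rw [hω.concaveMajorant_zero hωo]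
    exact (hω.nonneg ht).trans (hω.le_concaveMajorant hωo ht)
  · refine concaveMajorant_le hs fun y hy => ?_
    obtain ⟨ψ, -, hψ, hψy, hψmem⟩ := hω.exists_convexOn_of_mem hs0 hy
    have h1 := hω.le_concaveMajorant_of_mem hωo (hψmem (Real.log t))
    rw [Real.exp_log (hs0.trans_le hst)] at h1
    rw [← hψy]
    exact (hψ (Real.log_le_log hs0 hst)).trans h1

lemma concaveMajorant_nonneg (hω : IsWeightFunction ω) (hωo : ω =o[atTop] (fun t : ℝ => t))
    {t : ℝ} (ht : 0 ≤ t) : 0 ≤ concaveMajorant ω t :=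
  (hω.nonneg ht).trans (hω.le_concaveMajorant hωo ht)

lemma continuousOn_concaveMajorant (hω : IsWeightFunction ω)
    (hωo : ω =o[atTop] (fun t : ℝ => t)) : ContinuousOn (concaveMajorant ω) (Ici 0) := by
  have hopen : ContinuousOn (concaveMajorant ω) (Ioi 0) :=
    ((hω.concaveOn_concaveMajorant hωo).subset Ioi_subset_Ici_self (convex_Ioi 0)).continuousOn
      isOpen_Ioi
  intro t ht
  rcases (mem_Ici.1 ht).eq_or_lt with rfl | ht0
  · rw [Metric.continuousWithinAt_iff]
    intro ε hε
    obtain ⟨b, hb⟩ := hω.exists_mem_affineMajorants_of_pos hωo (half_pos hε)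
    have hb0 : 0 < b := hb.2.1
    refine ⟨ε / (2 * b), by positivity, fun s hs hsδ => ?_⟩
    have hs0 : 0 ≤ s := hs
    rw [Real.dist_eq, sub_zero, abs_of_nonneg hs0, lt_div_iff₀ (by positivity)] at hsδ
    rw [hω.concaveMajorant_zero hωo, Real.dist_eq, sub_zero,
      abs_of_nonneg (hω.concaveMajorant_nonneg hωo hs0)]
    have := concaveMajorant_le_of_mem hs0 hb
    simp only at this
    linarith
  · exact (hopen.continuousAt (Ioi_mem_nhds ht0)).continuousWithinAt

lemma isBigO_concaveMajorant (hω : IsWeightFunction ω) (hωo : ω =o[atTop] (fun t : ℝ => t)) :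
    ω =O[atTop] concaveMajorant ω := by
  refine IsBigO.of_bound 1 ?_
  filter_upwards [eventually_ge_atTop 0] with t ht
  rw [one_mul, Real.norm_of_nonneg (hω.nonneg ht),
    Real.norm_of_nonneg (hω.concaveMajorant_nonneg hωo ht)]
  exact hω.le_concaveMajorant hωo ht

lemma concaveMajorant_isWeightFunction (hω : IsWeightFunction ω)
    (hωo : ω =o[atTop] (fun t : ℝ => t)) : IsWeightFunction (concaveMajorant ω) where
  cont := hω.continuousOn_concaveMajorant hωo
  mono := hω.monotoneOn_concaveMajorant hωo
  map_zero := hω.concaveMajorant_zero hωo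
  tendsto := by
    refine tendsto_atTop_mono' _ ?_ hω.tendsto
    filter_upwards [eventually_ge_atTop 0] with t ht
    exact hω.le_concaveMajorant hωo ht
  doubling := by
    refine IsBigO.of_bound 2 ?_
    filter_upwards [eventually_ge_atTop 0] with t ht
    rw [Real.norm_of_nonneg (hω.concaveMajorant_nonneg hωo (by positivity)),
      Real.norm_of_nonneg (hω.concaveMajorant_nonneg hωo ht)]
    exact (hω.concaveOn_concaveMajorant hωo).map_mul_le (hω.concaveMajorant_zero hωo) one_le_two ht
  isBigO_id := by
    obtain ⟨b, hb⟩ := hω.exists_mem_affineMajorants_of_pos hωo one_pos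
    refine IsBigO.of_bound (1 + b) ?_
    filter_upwards [eventually_ge_atTop 1] with t ht
    have ht0 : 0 ≤ t := zero_le_one.trans ht
    rw [Real.norm_of_nonneg (hω.concaveMajorant_nonneg hωo ht0), Real.norm_of_nonneg ht0]
    have := concaveMajorant_le_of_mem ht0 hb
    simp only at this
    linarith
  log_isLittleO := hω.log_isLittleO.trans_isBigO (hω.isBigO_concaveMajorant hωo)
  convex := hω.convexOn_concaveMajorant_exp hωo

theorem weightEquiv_concaveMajorant (hω : IsWeightFunction ω)
    (hωo : ω =o[atTop] (fun t : ℝ => t)) (hb : SublinearGrowth ω) :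
    WeightEquiv ω (concaveMajorant ω) := by
  refine ⟨hω.isBigO_concaveMajorant hωo, ?_⟩
  obtain ⟨C, hC, T, hT1, h⟩ := hω.exists_mem_affineMajorants hb
  refine IsBigO.of_bound (1 + C) ?_
  filter_upwards [eventually_ge_atTop T] with t ht
  have ht0 : 0 < t := one_pos.trans_le (hT1.trans ht)
  obtain ⟨hx0, hp⟩ := h t ht
  rw [Real.norm_of_nonneg (hω.concaveMajorant_nonneg hωo ht0.le), Real.norm_of_nonneg hx0.le]
  have := concaveMajorant_le_of_mem ht0.le hp
  simp only [div_mul_cancel₀ _ ht0.ne'] at this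
  linarith

theorem sublinearGrowth_of_weightEquiv (hω : IsWeightFunction ω) {σ : ℝ → ℝ}
    (hσ : IsWeightFunction σ) (hconc : ConcaveOn ℝ (Ici 0) σ) (h : WeightEquiv ω σ) :
    SublinearGrowth ω := by
  obtain ⟨A, hA, hωσ⟩ := h.1.exists_pos
  obtain ⟨B, hB, hσω⟩ := h.2.exists_pos
  obtain ⟨T, hT⟩ := eventually_atTop.1 (hωσ.bound.and hσω.bound)
  refine ⟨A * B, by positivity, max T 1, by positivity, fun l hl t ht => ?_⟩
  have ht0 : 0 < t := one_pos.trans_le ((le_max_right _ _).trans ht)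
  have hl0 : 0 < l := one_pos.trans_le hl
  have htT : T ≤ t := (le_max_left _ _).trans ht
  have htl : t ≤ l * t := le_mul_of_one_le_left ht0.le hl
  have h1 := (hT (l * t) (htT.trans htl)).1
  have h2 := (hT t htT).2
  rw [Real.norm_of_nonneg (hω.nonneg (by positivity)),
    Real.norm_of_nonneg (hσ.nonneg (by positivity))] at h1
  rw [Real.norm_of_nonneg (hω.nonneg ht0.le), Real.norm_of_nonneg (hσ.nonneg ht0.le)] at h2
  have h3 := hconc.map_mul_le hσ.map_zero hl ht0.le
  calc ω (l * t) ≤ A * σ (l * t) := h1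
    _ ≤ A * (l * (B * ω t)) := by gcongr; exact h3.trans (by gcongr)
    _ = _ := by ring

end IsWeightFunction
end Ultradiff

namespace Ultradiff

open scoped BoundedContinuousFunction

/-! ### The cone of uniform limits of nonnegative cosine polynomials -/

/-- `x ↦ cos (m x)` as a bounded continuous function. -/
noncomputable def cosMode (m : ℤ) : ℝ →ᵇ ℝ :=
  BoundedContinuousFunction.ofNormedAddCommGroup (fun x => Real.cos (m * x)) (by fun_prop) 1
    fun x => Real.abs_cos_le_one _

@[simp] lemma cosMode_apply (m : ℤ) (x : ℝ) : cosMode m x = Real.cos (m * x) := rfl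

lemma norm_cosMode_le (m : ℤ) : ‖cosMode m‖ ≤ 1 :=
  (BoundedContinuousFunction.norm_le zero_le_one).2 fun _ => Real.abs_cos_le_one _

lemma cosMode_mul (l m : ℤ) :
    cosMode l * cosMode m = (1 / 2 : ℝ) • cosMode (l + m) + (1 / 2 : ℝ) • cosMode (l - m) := by
  ext x
  simp only [BoundedContinuousFunction.mul_apply, BoundedContinuousFunction.add_apply,
    BoundedContinuousFunction.smul_apply, cosMode_apply, smul_eq_mul]
  push_cast
  rw [add_mul, sub_mul, Real.cos_add, Real.cos_sub]
  ring

/-- Nonnegative multiples of cosine modes. -/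
def cosGenerators : Set (ℝ →ᵇ ℝ) := {h | ∃ c : ℝ, 0 ≤ c ∧ ∃ m : ℤ, h = c • cosMode m}

/-- Uniform limits of cosine polynomials with nonnegative coefficients. -/
noncomputable def cosCone : AddSubmonoid (ℝ →ᵇ ℝ) := (AddSubmonoid.closure cosGenerators).topologicalClosure

lemma smul_cosMode_mem_closure {c : ℝ} (hc : 0 ≤ c) (m : ℤ) :
    c • cosMode m ∈ AddSubmonoid.closure cosGenerators :=
  AddSubmonoid.subset_closure ⟨c, hc, m, rfl⟩

lemma smul_cosMode_mem {c : ℝ} (hc : 0 ≤ c) (m : ℤ) : c • cosMode m ∈ cosCone :=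
  AddSubmonoid.le_topologicalClosure _ (smul_cosMode_mem_closure hc m)

/-- The product-to-sum formula has nonnegative coefficients, and multiplication is continuous in the
uniform norm. -/
lemma cosCone_mul_mem {h g : ℝ →ᵇ ℝ} (hh : h ∈ cosCone) (hg : g ∈ cosCone) : h * g ∈ cosCone := by
  refine map_mem_closure₂ continuous_mul hh hg fun a ha b hb => ?_
  induction ha, hb using AddSubmonoid.closure_induction₂ with
  | mem x y hx hy =>
    obtain ⟨c, hc, l, rfl⟩ := hx
    obtain ⟨d, hd, m, rfl⟩ := hy
    rw [smul_mul_smul_comm, cosMode_mul, smul_add, smul_smul, smul_smul]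
    exact add_mem (smul_cosMode_mem_closure (by positivity) _)
      (smul_cosMode_mem_closure (by positivity) _)
  | zero_left => simp
  | zero_right => simp
  | add_left x y z _ _ _ h1 h2 => rw [add_mul]; exact add_mem h1 h2
  | add_right x y z _ _ _ h1 h2 => rw [mul_add]; exact add_mem h1 h2

lemma one_eq_cosMode : (1 : ℝ →ᵇ ℝ) = cosMode 0 := by
  ext x
  simp

lemma cosCone_pow_mem {h : ℝ →ᵇ ℝ} (hh : h ∈ cosCone) (n : ℕ) : h ^ n ∈ cosCone := by
  induction n with
  | zero =>
    rw [pow_zero, one_eq_cosMode]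
    simpa using smul_cosMode_mem zero_le_one 0
  | succ n ih => rw [pow_succ]; exact cosCone_mul_mem ih hh

lemma cosCone_hasSum_mem {ι : Type*} {f : ι → ℝ →ᵇ ℝ} {h : ℝ →ᵇ ℝ} (hf : ∀ i, f i ∈ cosCone)
    (hs : HasSum f h) : h ∈ cosCone :=
  (AddSubmonoid.isClosed_topologicalClosure _).mem_of_tendsto hs
    (Eventually.of_forall fun _ => sum_mem fun i _ => hf i)

lemma cosCone_hasSum_sub_mem {ι : Type*} {f : ι → ℝ →ᵇ ℝ} {h : ℝ →ᵇ ℝ}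
    (hf : ∀ i, f i ∈ cosCone) (hs : HasSum f h) (i : ι) : h - f i ∈ cosCone := by
  classical
  refine cosCone_hasSum_mem (f := fun j => if j = i then 0 else f j) (fun j => ?_)
    (hasSum_ite_sub_hasSum hs i)
  split_ifs
  · exact zero_mem _
  · exact hf j

/-- In the order of the cone, a lower bound for h by one mode passes to powers. Multiplying two
modes puts half of the mass at the sum of the frequencies; the other half, at the difference, stays
in the cone and may be dropped. -/
lemma pow_sub_smul_cosMode_mem {h : ℝ →ᵇ ℝ} (hh : h ∈ cosCone) {a : ℝ} (ha : 0 ≤ a) {j : ℤ}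
    (hj : h - a • cosMode j ∈ cosCone) (n : ℕ) :
    h ^ n - (a / 2) ^ n • cosMode (n * j) ∈ cosCone := by
  induction n with
  | zero =>
    simp [one_eq_cosMode, zero_mem]
  | succ n ih =>
    have e : h ^ (n + 1) - (a / 2) ^ (n + 1) • cosMode ((n + 1 : ℕ) * j) =
        h * (h ^ n - (a / 2) ^ n • cosMode (n * j)) +
        (h - a • cosMode j) * ((a / 2) ^ n • cosMode (n * j)) +
        (a / 2) ^ (n + 1) • cosMode (j - n * j) := by
      have e1 : (a • cosMode j) * ((a / 2) ^ n • cosMode (n * j)) =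
          (a / 2) ^ (n + 1) • cosMode ((n + 1 : ℕ) * j) +
          (a / 2) ^ (n + 1) • cosMode (j - n * j) := by
        rw [smul_mul_smul_comm, cosMode_mul, smul_add, smul_smul, smul_smul,
          show j + n * j = ((n + 1 : ℕ) : ℤ) * j by push_cast; ring,
          show a * (a / 2) ^ n * (1 / 2) = (a / 2) ^ (n + 1) by ring]
      rw [sub_mul, e1]
      ring
    rw [e]
    exact add_mem (add_mem (cosCone_mul_mem hh ih)
      (cosCone_mul_mem hj (smul_cosMode_mem (by positivity) _)))
      (smul_cosMode_mem (by positivity) _)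

lemma integral_cos_int_mul (p : ℤ) :
    ∫ x in (-Real.pi)..Real.pi, Real.cos (p * x) = if p = 0 then 2 * Real.pi else 0 := by
  split_ifs with h
  · simp [h]
    ring
  · have hp : (p : ℝ) ≠ 0 := by exact_mod_cast h
    rw [intervalIntegral.integral_comp_mul_left (fun x => Real.cos x) hp, integral_cos]
    simp [Real.sin_int_mul_pi]

lemma integral_cosMode_mul (l m : ℤ) :
    ∫ x in (-Real.pi)..Real.pi, cosMode l x * Real.cos (m * x) =
      1 / 2 * (if l + m = 0 then 2 * Real.pi else 0) +
      1 / 2 * (if l - m = 0 then 2 * Real.pi else 0) := by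
  rw [← integral_cos_int_mul, ← integral_cos_int_mul, ← intervalIntegral.integral_const_mul,
    ← intervalIntegral.integral_const_mul, ← intervalIntegral.integral_add]
  · refine intervalIntegral.integral_congr fun x _ => ?_
    have := congrArg (fun h : ℝ →ᵇ ℝ => h x) (cosMode_mul l m)
    simpa using this
  · exact Continuous.intervalIntegrable (by fun_prop) _ _
  · exact Continuous.intervalIntegrable (by fun_prop) _ _

/-- The cosine coefficient (up to normalization) as a continuous linear functional. -/
noncomputable def cosCoeff (m : ℤ) : (ℝ →ᵇ ℝ) →L[ℝ] ℝ :=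
  LinearMap.mkContinuous
    { toFun := fun h => ∫ x in (-Real.pi)..Real.pi, h x * Real.cos (m * x)
      map_add' := fun h g => by
        rw [← intervalIntegral.integral_add]
        · simp only [BoundedContinuousFunction.add_apply, add_mul]
        · exact Continuous.intervalIntegrable (by fun_prop) _ _
        · exact Continuous.intervalIntegrable (by fun_prop) _ _
      map_smul' := fun c h => by
        simp only [BoundedContinuousFunction.smul_apply, smul_eq_mul, RingHom.id_apply]
        rw [← intervalIntegral.integral_const_mul]
        simp only [mul_assoc] } (2 * Real.pi) fun h => by
    have := intervalIntegral.norm_integral_le_of_norm_le_const (a := -Real.pi) (b := Real.pi)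
      (f := fun x => h x * Real.cos (m * x)) (C := ‖h‖) fun x _ => by
        rw [norm_mul]
        exact (mul_le_mul (h.norm_coe_le_norm x) (Real.abs_cos_le_one _) (abs_nonneg _)
          (norm_nonneg _)).trans_eq (mul_one _)
    refine this.trans_eq ?_
    rw [show Real.pi - -Real.pi = 2 * Real.pi by ring, abs_of_pos Real.two_pi_pos]
    ring

lemma cosCoeff_apply (m : ℤ) (h : ℝ →ᵇ ℝ) :
    cosCoeff m h = ∫ x in (-Real.pi)..Real.pi, h x * Real.cos (m * x) := rfl

lemma cosCoeff_nonneg {h : ℝ →ᵇ ℝ} (hh : h ∈ cosCone) (m : ℤ) : 0 ≤ cosCoeff m h := by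
  have hcl : IsClosed {h : ℝ →ᵇ ℝ | 0 ≤ cosCoeff m h} :=
    isClosed_le continuous_const (cosCoeff m).continuous
  refine closure_minimal (fun g hg => ?_) hcl hh
  simp only [mem_ofPred_eq]
  induction hg using AddSubmonoid.closure_induction with
  | mem x hx =>
    obtain ⟨c, hc, l, rfl⟩ := hx
    rw [map_smul, cosCoeff_apply, integral_cosMode_mul, smul_eq_mul]
    have := Real.pi_pos
    refine mul_nonneg hc (add_nonneg ?_ ?_) <;> split_ifs <;> positivity
  | zero => simp
  | add x y _ _ h1 h2 => rw [map_add]; exact add_nonneg h1 h2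

lemma pi_le_cosCoeff_cosMode (m : ℤ) : Real.pi ≤ cosCoeff m (cosMode m) := by
  rw [cosCoeff_apply, integral_cosMode_mul, sub_self, if_pos rfl]
  have := Real.pi_pos
  have : 0 ≤ 1 / 2 * (if m + m = 0 then 2 * Real.pi else 0) := by split_ifs <;> positivity
  linarith

/-- Lower bound for the cosine coefficients of `1 / (1 - h)` for `h` in the cone. -/
lemma le_integral_inv_one_sub {h : ℝ →ᵇ ℝ} (hh : h ∈ cosCone) (hn : ‖h‖ < 1) {a : ℝ}
    (ha : 0 ≤ a) {j : ℤ} (hj : h - a • cosMode j ∈ cosCone) (n : ℕ) :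
    (a / 2) ^ n * Real.pi ≤
      ∫ x in (-Real.pi)..Real.pi, (1 - h x)⁻¹ * Real.cos ((n * j : ℤ) * x) := by
  have hs : HasSum (fun m : ℕ => h ^ m) (∑' m : ℕ, h ^ m) :=
    (summable_geometric_of_norm_lt_one hn).hasSum
  set G := ∑' m : ℕ, h ^ m with hG
  have hGx : ∀ x, G x = (1 - h x)⁻¹ := by
    intro x
    have h1 : HasSum (fun m : ℕ => (h ^ m) x) (G x) :=
      hs.map (BoundedContinuousFunction.evalCLM ℝ x) (BoundedContinuousFunction.evalCLM ℝ x).continuous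
    have h2 : HasSum (fun m : ℕ => (h x) ^ m) (1 - h x)⁻¹ :=
      hasSum_geometric_of_norm_lt_one ((h.norm_coe_le_norm x).trans_lt hn)
    exact h1.unique (by simpa using h2)
  -- Dropping all terms of the geometric series except the n-th only decreases it in the cone order.
  have hmem : G - (a / 2) ^ n • cosMode (n * j) ∈ cosCone := by
    have := add_mem (cosCone_hasSum_sub_mem (fun m => cosCone_pow_mem hh m) hs n)
      (pow_sub_smul_cosMode_mem hh ha hj n)
    simpa using this
  have h1 := cosCoeff_nonneg hmem (n * j)
  rw [map_sub, map_smul, smul_eq_mul, sub_nonneg] at h1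
  have h2 := mul_le_mul_of_nonneg_left (pi_le_cosCoeff_cosMode (n * j))
    (show 0 ≤ (a / 2) ^ n by positivity)
  refine (h2.trans h1).trans_eq ?_
  rw [cosCoeff_apply]
  simp only [hGx]

/-! ### Decay of Fourier coefficients -/

/-- Integrate by parts k times; periodicity removes the boundary terms. The phase θ lets the
induction close, each step shifting it by π/2. -/
lemma abs_integral_mul_cos_le {G : ℝ → ℝ} (hG : ContDiff ℝ (⊤ : ℕ∞) G)
    (hper : Function.Periodic G (2 * Real.pi)) (m : ℤ) (k : ℕ) {B : ℝ}
    (hB : ∀ x, |iteratedDeriv k G x| ≤ B) (θ : ℝ) :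
    |∫ x in (-Real.pi)..Real.pi, G x * Real.cos (m * x + θ)| * |(m : ℝ)| ^ k ≤
      2 * Real.pi * B := by
  induction k generalizing G θ with
  | zero =>
    have := intervalIntegral.norm_integral_le_of_norm_le_const (a := -Real.pi) (b := Real.pi)
      (f := fun x => G x * Real.cos (m * x + θ)) (C := B) fun x _ => by
        rw [norm_mul]
        have hBx : |G x| ≤ B := by simpa using hB x
        exact (mul_le_mul hBx (Real.abs_cos_le_one _) (abs_nonneg _)
          ((abs_nonneg _).trans hBx)).trans_eq (mul_one _)
    rw [show Real.pi - -Real.pi = 2 * Real.pi by ring, abs_of_pos Real.two_pi_pos] at this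
    simpa [mul_comm] using this
  | succ k ih =>
    have hd : ∀ x, HasDerivAt G (deriv G x) x := fun x =>
      (hG.differentiable (by simp)).differentiableAt.hasDerivAt
    have hG' : ContDiff ℝ (⊤ : ℕ∞) (deriv G) := (contDiff_infty_iff_deriv.1 hG).2
    have hper' : Function.Periodic (deriv G) (2 * Real.pi) := by
      intro x
      rw [← deriv_comp_add_const, funext hper]
    have h1 := ih hG' hper' (fun x => by rw [← iteratedDeriv_succ']; exact hB x) (θ + Real.pi / 2)
    have hs : ∀ x, HasDerivAt (fun x => Real.sin (m * x + θ)) (m * Real.cos (m * x + θ)) x := by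
      intro x
      have : HasDerivAt (fun x : ℝ => m * x + θ) m x := by
        simpa using ((hasDerivAt_id x).const_mul (m : ℝ)).add_const θ
      simpa [mul_comm] using this.sin
    have h2 := intervalIntegral.integral_mul_deriv_eq_deriv_mul (a := -Real.pi) (b := Real.pi)
      (fun x _ => hd x) (fun x _ => hs x)
      (hG'.continuous.intervalIntegrable _ _)
      (Continuous.intervalIntegrable (by fun_prop) _ _)
    have h3 : G Real.pi = G (-Real.pi) := by
      rw [← hper (-Real.pi)]
      ring_nf
    have h4 : Real.sin (m * Real.pi + θ) = Real.sin (m * -Real.pi + θ) := by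
      rw [show (m : ℝ) * Real.pi + θ = m * -Real.pi + θ + m * (2 * Real.pi) by ring,
        Real.sin_add_int_mul_two_pi]
    rw [h3, h4, sub_self, zero_sub] at h2
    have h5 : ∫ x in (-Real.pi)..Real.pi, deriv G x * Real.cos (m * x + (θ + Real.pi / 2)) =
        m * ∫ x in (-Real.pi)..Real.pi, G x * Real.cos (m * x + θ) := by
      rw [← intervalIntegral.integral_const_mul]
      calc _ = -∫ x in (-Real.pi)..Real.pi, deriv G x * Real.sin (m * x + θ) := by
            rw [← intervalIntegral.integral_neg]
            refine intervalIntegral.integral_congr fun x _ => ?_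
            rw [← add_assoc, Real.cos_add_pi_div_two]
            ring
        _ = _ := by
            rw [← h2]
            refine intervalIntegral.integral_congr fun x _ => ?_
            ring
    rw [h5, abs_mul] at h1
    calc _ = |(m : ℝ)| * |∫ x in (-Real.pi)..Real.pi, G x * Real.cos (m * x + θ)| *
          |(m : ℝ)| ^ k := by ring
      _ ≤ _ := h1

end Ultradiff

namespace Ultradiff

/-! ### Functions of one variable -/

/-- The coordinate `Rn 1 ≃ ℝ`. -/
noncomputable def coordIsometry : Rn 1 ≃ₗᵢ[ℝ] ℝ where
  toLinearEquiv := (PiLp.equivOfUnique 2 ℝ (fun _ : Fin 1 => ℝ)).toLinearEquiv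
  norm_map' x := by
    rw [EuclideanSpace.norm_eq, Fin.sum_univ_one, Real.sqrt_sq (norm_nonneg _)]
    rfl

lemma coordIsometry_apply (x : Rn 1) : coordIsometry x = x 0 := rfl

lemma norm_iteratedFDeriv_coord (u : ℝ → ℝ) (k : ℕ) (x : Rn 1) :
    ‖iteratedFDeriv ℝ k (fun x : Rn 1 => u (x 0)) x‖ = |iteratedDeriv k u (x 0)| := by
  rw [← Real.norm_eq_abs, ← norm_iteratedFDeriv_eq_norm_iteratedDeriv, ← coordIsometry_apply,
    ← coordIsometry.norm_iteratedFDeriv_comp_right u x k]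
  rfl

lemma derivBound_coord {u : ℝ → ℝ} {U : Set (Rn 1)} {w : ℕ → ℝ} {C : ℝ}
    (h : ∀ k, ∀ x ∈ U, |iteratedDeriv k u (x 0)| ≤ C * w k) :
    DerivBound U w (fun x => u (x 0)) :=
  ⟨C, fun k _ x hx => (abs_iteratedPartial_le _ _ _ _).trans
    ((norm_iteratedFDeriv_coord u k x).trans_le (h k x hx))⟩

lemma DerivBound.exists_iteratedDeriv_le {u : ℝ → ℝ} {w : ℕ → ℝ} (hw : ∀ k, 0 ≤ w k)
    (h : DerivBound univ w (fun x : Rn 1 => u (x 0))) :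
    ∃ C, 0 < C ∧ ∀ k t, |iteratedDeriv k u t| ≤ C * w k := by
  obtain ⟨C, hC⟩ := h
  have hC1 : 0 < max C 1 := lt_max_of_lt_right one_pos
  refine ⟨max C 1, hC1, fun k t => ?_⟩
  have h1 := norm_iteratedFDeriv_le_of_iteratedPartial (C := max C 1 * w k)
    (x := EuclideanSpace.single (0 : Fin 1) t) (fun i =>
    (hC k i _ (mem_univ _)).trans (mul_le_mul_of_nonneg_right (le_max_left _ _) (hw k)))
    (mul_nonneg hC1.le (hw k))
  rw [norm_iteratedFDeriv_coord] at h1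
  simpa using h1

lemma abs_iteratedDeriv_inv_one_sub_le (k : ℕ) {x : ℝ} (hx : x < 3 / 4) :
    |iteratedDeriv k (fun y : ℝ => (1 - y)⁻¹) x| ≤ 4 * (4 ^ k * k !) := by
  have e : (fun y : ℝ => (1 - y)⁻¹) = fun y : ℝ => (-1 * y + 1)⁻¹ := by
    funext y
    ring_nf
  rw [e, iteratedDeriv_eq_iterate, iter_deriv_inv_linear]
  beta_reduce
  have h1 : (1 / 4 : ℝ) ≤ -1 * x + 1 := by linarith
  have h2 : (-1 * x + 1 : ℝ) ^ (-1 - k : ℤ) = ((-1 * x + 1 : ℝ) ^ (k + 1))⁻¹ := by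
    rw [show (-1 - k : ℤ) = -((k + 1 : ℕ) : ℤ) by push_cast; ring, zpow_neg, zpow_natCast]
  have h3 : ((-1 * x + 1 : ℝ) ^ (k + 1))⁻¹ ≤ 4 ^ (k + 1) := by
    rw [inv_le_comm₀ (by positivity) (by positivity), ← inv_pow]
    gcongr
    linarith
  rw [h2, mul_right_comm ((-1 : ℝ) ^ k), ← mul_pow, neg_one_mul, neg_neg, one_pow, one_mul,
    abs_of_nonneg (by positivity)]
  calc (k ! : ℝ) * ((-1 * x + 1 : ℝ) ^ (k + 1))⁻¹ ≤ k ! * 4 ^ (k + 1) := by gcongr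
    _ = _ := by ring

/-! ### Lacunary cosine series -/

/-- The coefficients `2 ^ (-i - 2) exp (-(i + 1) ω (j_i))`. -/
noncomputable def lacunaryCoeff (ω : ℝ → ℝ) (j : ℕ → ℕ) (i : ℕ) : ℝ :=
  (1 / 2) ^ (i + 2) * Real.exp (-((i + 1) * ω (j i)))

/-- The series of `lacunaryCoeff ω j i * cos (j_i x)`. -/
noncomputable def lacunarySeries (ω : ℝ → ℝ) (j : ℕ → ℕ) (x : ℝ) : ℝ :=
  ∑' i, lacunaryCoeff ω j i * Real.cos (j i * x)

lemma lacunaryCoeff_pos (ω : ℝ → ℝ) (j : ℕ → ℕ) (i : ℕ) : 0 < lacunaryCoeff ω j i := by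
  rw [lacunaryCoeff]
  positivity

lemma abs_iteratedDeriv_mul_cos_le (a b : ℝ) (ha : 0 ≤ a) (hb : 0 ≤ b) (k : ℕ) (x : ℝ) :
    |iteratedDeriv k (fun x => a * Real.cos (b * x)) x| ≤ a * b ^ k := by
  rw [iteratedDeriv_const_mul_field, iteratedDeriv_comp_const_mul Real.contDiff_cos, abs_mul,
    abs_mul, abs_of_nonneg ha, abs_of_nonneg (pow_nonneg hb k)]
  have := Real.abs_iteratedDeriv_cos_le_one k (b * x)
  gcongr
  exact mul_le_of_le_one_right (by positivity) this

lemma hasSum_half_pow_add_two : HasSum (fun i : ℕ => (1 / 2 : ℝ) ^ (i + 2)) (1 / 2) := by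
  have := hasSum_geometric_two.mul_left (1 / 4 : ℝ)
  rw [show (1 / 4 : ℝ) * 2 = 1 / 2 by norm_num] at this
  refine this.congr_fun fun i => ?_
  ring

namespace IsWeightFunction

variable {ω : ℝ → ℝ}

lemma lacunaryCoeff_le (hω : IsWeightFunction ω) (j : ℕ → ℕ) (i : ℕ) :
    lacunaryCoeff ω j i ≤ (1 / 2) ^ (i + 2) := by
  refine mul_le_of_le_one_right (by positivity) (Real.exp_le_one_iff.2 (neg_nonpos.2 ?_))
  have := hω.nonneg (Nat.cast_nonneg (α := ℝ) (j i))
  positivity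

/-- The factor i + 1 in the exponent eventually exceeds 1/ρ, and the finitely many earlier terms go
into the constant. Since ρ is arbitrary, the series is in the Beurling class. -/
lemma exists_lacunaryCoeff_mul_pow_le (hω : IsWeightFunction ω) {j : ℕ → ℕ} (hj : ∀ i, 1 ≤ j i)
    {ρ : ℝ} (hρ : 0 < ρ) : ∃ C : ℝ, 0 < C ∧ ∀ k i : ℕ,
      lacunaryCoeff ω j i * (j i : ℝ) ^ k ≤ (1 / 2) ^ (i + 2) * (C * weightSeq ω ρ k) := by
  set N := ⌈1 / ρ⌉₊ with hN
  have h0 : ∀ i, 0 ≤ ω (j i) := fun i => hω.nonneg (Nat.cast_nonneg (α := ℝ) (j i))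
  set C := 1 + ∑ i ∈ Finset.range N, Real.exp (ω (j i) / ρ) with hC
  have hsum : 0 ≤ ∑ i ∈ Finset.range N, Real.exp (ω (j i) / ρ) :=
    Finset.sum_nonneg fun i _ => (Real.exp_pos _).le
  have key : ∀ i, Real.exp (-((i + 1) * ω (j i))) * Real.exp (ω (j i) / ρ) ≤ C := by
    intro i
    rw [← Real.exp_add]
    rcases lt_or_ge i N with h | h
    · have h1 : Real.exp (ω (j i) / ρ) ≤ ∑ i ∈ Finset.range N, Real.exp (ω (j i) / ρ) :=
        Finset.single_le_sum (f := fun i => Real.exp (ω (j i) / ρ))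
          (fun i _ => (Real.exp_pos _).le) (Finset.mem_range.2 h)
      have h2 : 0 ≤ (i + 1 : ℝ) * ω (j i) := mul_nonneg (by positivity) (h0 i)
      calc _ ≤ Real.exp (ω (j i) / ρ) := Real.exp_le_exp.2 (by linarith)
        _ ≤ C := by linarith
    · have h1 : 1 / ρ ≤ i + 1 := by
        have : (N : ℝ) ≤ i := by exact_mod_cast h
        have := Nat.le_ceil (1 / ρ)
        rw [← hN] at this
        linarith
      have h2 := mul_le_mul_of_nonneg_right h1 (h0 i)
      have e : ω (j i) / ρ = 1 / ρ * ω (j i) := by ring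
      calc _ ≤ (1 : ℝ) := Real.exp_le_one_iff.2 (by rw [e]; linarith)
        _ ≤ C := by linarith
  refine ⟨C, by positivity, fun k i => ?_⟩
  have h1 := hω.pow_mul_exp_le_weightSeq hρ (t := j i) (by exact_mod_cast hj i) k
  rw [lacunaryCoeff, mul_assoc]
  refine mul_le_mul_of_nonneg_left ?_ (by positivity)
  calc Real.exp (-((i + 1) * ω (j i))) * (j i : ℝ) ^ k
      = (Real.exp (-((i + 1) * ω (j i))) * Real.exp (ω (j i) / ρ)) *
        ((j i : ℝ) ^ k * Real.exp (-(ω (j i) / ρ))) := by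
        rw [Real.exp_neg (ω (j i) / ρ)]
        field_simp
    _ ≤ C * weightSeq ω ρ k := mul_le_mul (key i) h1 (by positivity) (by positivity)

lemma summable_lacunaryCoeff_mul_pow (hω : IsWeightFunction ω) {j : ℕ → ℕ} (hj : ∀ i, 1 ≤ j i)
    (k : ℕ) : Summable fun i => lacunaryCoeff ω j i * (j i : ℝ) ^ k := by
  obtain ⟨C, hC, h⟩ := hω.exists_lacunaryCoeff_mul_pow_le hj one_pos
  refine Summable.of_nonneg_of_le (fun i => ?_) (h k) (hasSum_half_pow_add_two.summable.mul_right _)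
  have := lacunaryCoeff_pos ω j i
  positivity

lemma norm_iteratedFDeriv_lacunaryTerm_le (ω : ℝ → ℝ) (j : ℕ → ℕ) (k i : ℕ) (x : ℝ) :
    ‖iteratedFDeriv ℝ k (fun x => lacunaryCoeff ω j i * Real.cos (j i * x)) x‖ ≤
      lacunaryCoeff ω j i * (j i : ℝ) ^ k := by
  rw [norm_iteratedFDeriv_eq_norm_iteratedDeriv]
  exact abs_iteratedDeriv_mul_cos_le _ _ (lacunaryCoeff_pos ω j i).le (Nat.cast_nonneg _) k x

lemma contDiff_lacunarySeries (hω : IsWeightFunction ω) {j : ℕ → ℕ} (hj : ∀ i, 1 ≤ j i) :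
    ContDiff ℝ (⊤ : ℕ∞) (lacunarySeries ω j) :=
  contDiff_tsum (N := (⊤ : ℕ∞)) (v := fun k i => lacunaryCoeff ω j i * (j i : ℝ) ^ k)
    (fun i => by fun_prop) (fun k _ => hω.summable_lacunaryCoeff_mul_pow hj k)
    (fun k i x _ => norm_iteratedFDeriv_lacunaryTerm_le ω j k i x)

lemma abs_iteratedDeriv_lacunarySeries_le (hω : IsWeightFunction ω) {j : ℕ → ℕ}
    (hj : ∀ i, 1 ≤ j i) {ρ : ℝ} (hρ : 0 < ρ) :
    ∃ C, ∀ k x, |iteratedDeriv k (lacunarySeries ω j) x| ≤ C * weightSeq ω ρ k := by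
  obtain ⟨C, hC, h⟩ := hω.exists_lacunaryCoeff_mul_pow_le hj hρ
  refine ⟨1 / 2 * C, fun k x => ?_⟩
  rw [← Real.norm_eq_abs, ← norm_iteratedFDeriv_eq_norm_iteratedDeriv]
  have h1 := iteratedFDeriv_tsum_apply (N := (⊤ : ℕ∞))
    (v := fun k i => lacunaryCoeff ω j i * (j i : ℝ) ^ k)
    (f := fun i x => lacunaryCoeff ω j i * Real.cos (j i * x))
    (fun i => by fun_prop) (fun k _ => hω.summable_lacunaryCoeff_mul_pow hj k)
    (fun k i x _ => norm_iteratedFDeriv_lacunaryTerm_le ω j k i x) (k := k) le_top x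
  have h2 : iteratedFDeriv ℝ k (lacunarySeries ω j) x = _ := h1
  rw [h2, mul_assoc]
  exact tsum_of_norm_bounded (hasSum_half_pow_add_two.mul_right _)
    fun i => (norm_iteratedFDeriv_lacunaryTerm_le ω j k i x).trans (h k i)

lemma summable_lacunaryCoeff_smul_cosMode (hω : IsWeightFunction ω) (j : ℕ → ℕ) :
    Summable fun i => lacunaryCoeff ω j i • cosMode (j i) := by
  refine Summable.of_norm_bounded hasSum_half_pow_add_two.summable fun i => ?_
  rw [norm_smul, Real.norm_of_nonneg (lacunaryCoeff_pos ω j i).le]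
  exact (mul_le_of_le_one_right (lacunaryCoeff_pos ω j i).le (norm_cosMode_le _)).trans
    (hω.lacunaryCoeff_le j i)

lemma norm_tsum_lacunary_le (hω : IsWeightFunction ω) (j : ℕ → ℕ) :
    ‖∑' i, lacunaryCoeff ω j i • cosMode (j i)‖ ≤ 1 / 2 := by
  refine tsum_of_norm_bounded hasSum_half_pow_add_two fun i => ?_
  rw [norm_smul, Real.norm_of_nonneg (lacunaryCoeff_pos ω j i).le]
  exact (mul_le_of_le_one_right (lacunaryCoeff_pos ω j i).le (norm_cosMode_le _)).trans
    (hω.lacunaryCoeff_le j i)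

lemma tsum_lacunary_apply (hω : IsWeightFunction ω) (j : ℕ → ℕ) (x : ℝ) :
    (∑' i, lacunaryCoeff ω j i • cosMode (j i)) x = lacunarySeries ω j x := by
  have h1 := (hω.summable_lacunaryCoeff_smul_cosMode j).hasSum.map
    (BoundedContinuousFunction.evalCLM ℝ x) (BoundedContinuousFunction.evalCLM ℝ x).continuous
  exact (h1.tsum_eq.symm).trans rfl

lemma abs_lacunarySeries_le (hω : IsWeightFunction ω) (j : ℕ → ℕ) (x : ℝ) :
    |lacunarySeries ω j x| ≤ 1 / 2 := by
  rw [← hω.tsum_lacunary_apply]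
  exact (BoundedContinuousFunction.norm_coe_le_norm _ x).trans (hω.norm_tsum_lacunary_le j)

lemma periodic_lacunarySeries (ω : ℝ → ℝ) (j : ℕ → ℕ) :
    Function.Periodic (lacunarySeries ω j) (2 * Real.pi) := by
  intro x
  refine tsum_congr fun i => ?_
  rw [mul_add, Real.cos_add_nat_mul_two_pi]

lemma le_integral_inv_one_sub_lacunarySeries (hω : IsWeightFunction ω) (j : ℕ → ℕ) (i n : ℕ) :
    (lacunaryCoeff ω j i / 2) ^ n * Real.pi ≤
      ∫ x in (-Real.pi)..Real.pi,
        (1 - lacunarySeries ω j x)⁻¹ * Real.cos ((n * j i : ℤ) * x) := by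
  have hs := (hω.summable_lacunaryCoeff_smul_cosMode j).hasSum
  have hmem : ∀ i, lacunaryCoeff ω j i • cosMode (j i) ∈ cosCone := fun i =>
    smul_cosMode_mem (lacunaryCoeff_pos ω j i).le _
  have := le_integral_inv_one_sub (cosCone_hasSum_mem hmem hs)
    ((hω.norm_tsum_lacunary_le j).trans_lt (by norm_num)) (lacunaryCoeff_pos ω j i).le
    (cosCone_hasSum_sub_mem hmem hs i) n
  simpa only [hω.tsum_lacunary_apply] using this

/-! ### Stability under composition forces sublinear growth -/

lemma exists_lt_of_not_sublinearGrowth (hω : IsWeightFunction ω) (h : ¬ SublinearGrowth ω)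
    (A : ℝ) (hA : 0 < A) : ∃ n j : ℕ, 1 ≤ n ∧ 1 ≤ j ∧ 1 ≤ ω j ∧ A * (n * ω j) < ω (n * j) := by
  obtain ⟨L, hL, D, hD, hLD⟩ := hω.exists_le_two_mul
  have hL0 : 0 < L := one_pos.trans_le hL
  obtain ⟨T, hT⟩ := eventually_atTop.1 (hω.tendsto.eventually_ge_atTop (max D 1))
  simp only [SublinearGrowth, not_exists, not_and] at h
  -- Rounding l and t up to integers costs a factor 2 for l, and a factor L + 1 for ω(t) by
  -- doubling, where ω(t) ≥ D absorbs the additive constant.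
  have h1 := h (A * (2 * (L + 1))) (by positivity) (max T 1) (lt_max_of_lt_right one_pos)
  push Not at h1
  obtain ⟨l, hl, t, ht, hlt⟩ := h1
  have ht1 : 1 ≤ t := (le_max_right _ _).trans ht
  have ht0 : 0 < t := one_pos.trans_le ht1
  have hl0 : 0 < l := one_pos.trans_le hl
  have hωt := hT t ((le_max_left _ _).trans ht)
  have hωt1 : 1 ≤ ω t := (le_max_right _ _).trans hωt
  have hωtD : D ≤ ω t := (le_max_left _ _).trans hωt
  have hn1 : l ≤ ⌈l⌉₊ := Nat.le_ceil l
  have hj1 : t ≤ ⌈t⌉₊ := Nat.le_ceil t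
  have hn2 : (⌈l⌉₊ : ℝ) ≤ 2 * l := by
    have := Nat.ceil_lt_add_one hl0.le
    linarith
  have hj2 : (⌈t⌉₊ : ℝ) ≤ 2 * t := by
    have := Nat.ceil_lt_add_one ht0.le
    linarith
  have hωj1 : ω t ≤ ω ⌈t⌉₊ := hω.le_of_le ht0.le hj1
  have hωj2 : ω ⌈t⌉₊ ≤ (L + 1) * ω t := by
    have h2 := hω.le_of_le (Nat.cast_nonneg (α := ℝ) ⌈t⌉₊) hj2
    have h3 := hLD t ht0.le
    linarith
  refine ⟨⌈l⌉₊, ⌈t⌉₊, Nat.one_le_ceil_iff.2 hl0, Nat.one_le_ceil_iff.2 ht0,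
    hωt1.trans hωj1, ?_⟩
  calc A * (⌈l⌉₊ * ω ⌈t⌉₊) ≤ A * ((2 * l) * ((L + 1) * ω t)) := by
        have := hω.nonneg (Nat.cast_nonneg (α := ℝ) ⌈t⌉₊)
        gcongr
    _ = A * (2 * (L + 1)) * l * ω t := by ring
    _ < ω (l * t) := hlt
    _ ≤ ω (⌈l⌉₊ * ⌈t⌉₊) := hω.le_of_le (by positivity) (by gcongr)

lemma coord_mem_beurlingWeight (hω : IsWeightFunction ω) {j : ℕ → ℕ} (hj : ∀ i, 1 ≤ j i) :
    (fun x : Rn 1 => lacunarySeries ω j (x 0)) ∈ beurlingWeight ω 1 univ := by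
  refine ⟨?_, fun ρ hρ => ?_⟩
  · exact ((hω.contDiff_lacunarySeries hj).comp coordIsometry.contDiff).contDiffOn
  · obtain ⟨C, hC⟩ := hω.abs_iteratedDeriv_lacunarySeries_le hj hρ
    exact derivBound_coord fun k x _ => hC k (x 0)

lemma inv_one_sub_mem_beurlingWeight (hω : IsWeightFunction ω)
    (hωo : ω =o[atTop] (fun t : ℝ => t)) :
    (fun y : Rn 1 => (1 - y 0)⁻¹) ∈ beurlingWeight ω 1 {y | y 0 < 3 / 4} := by
  refine ⟨?_, fun ρ hρ => ?_⟩
  · refine ContDiffOn.inv ?_ fun y hy => ?_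
    · exact (contDiff_const.sub coordIsometry.contDiff).contDiffOn
    · have : y 0 < 3 / 4 := hy
      linarith
  · obtain ⟨C, hC, h⟩ := hω.exists_pow_mul_factorial_le hωo (show (0 : ℝ) < 4 by norm_num) hρ
    refine derivBound_coord (u := fun y => (1 - y)⁻¹) (C := 4 * C) fun k y hy => ?_
    refine (abs_iteratedDeriv_inv_one_sub_le k hy).trans ?_
    rw [mul_assoc]
    exact mul_le_mul_of_nonneg_left (h k) (by norm_num)

/-- The hypothesis takes Beurling data and asks only for a Roumieu composite, so stability of either
class implies it. -/
theorem sublinearGrowth_of_comp_mem (hω : IsWeightFunction ω)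
    (hωo : ω =o[atTop] (fun t : ℝ => t))
    (H : ∀ U V : Set (Rn 1), IsOpen U → IsOpen V → ∀ g : Rn 1 → Rn 1,
      (∀ l, (fun x => g x l) ∈ beurlingWeight ω 1 U) → MapsTo g U V →
      ∀ f ∈ beurlingWeight ω 1 V, f ∘ g ∈ roumieuWeight ω 1 U) : SublinearGrowth ω := by
  by_contra hnot
  -- The square beats the linear growth in i of the exponents in the lacunary coefficients.
  choose n j hn hj hωj hlt using fun i : ℕ =>
    hω.exists_lt_of_not_sublinearGrowth hnot ((i + 1 : ℝ) ^ 2) (by positivity)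
  have hopen : IsOpen {y : Rn 1 | y 0 < 3 / 4} :=
    isOpen_lt coordIsometry.continuous continuous_const
  have hlt34 : ∀ x, lacunarySeries ω j x < 3 / 4 := fun x =>
    ((le_abs_self _).trans (hω.abs_lacunarySeries_le j x)).trans_lt (by norm_num)
  obtain ⟨-, ρ, hρ, hb⟩ := H univ {y | y 0 < 3 / 4} isOpen_univ hopen
    (fun x => WithLp.toLp 2 fun _ => lacunarySeries ω j (x 0))
    (fun l => hω.coord_mem_beurlingWeight hj) (fun x _ => hlt34 (x 0)) _
    (hω.inv_one_sub_mem_beurlingWeight hωo)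
  set G : ℝ → ℝ := fun x => (1 - lacunarySeries ω j x)⁻¹ with hG
  obtain ⟨C, hC, hGb⟩ := DerivBound.exists_iteratedDeriv_le (u := G)
    (fun k => (weightSeq_pos ω ρ k).le) hb
  have hGs : ContDiff ℝ (⊤ : ℕ∞) G := by
    refine ContDiff.inv (contDiff_const.sub (hω.contDiff_lacunarySeries hj)) fun x => ?_
    have := hlt34 x
    linarith
  have hGp : Function.Periodic G (2 * Real.pi) := fun x => by
    simp only [hG, periodic_lacunarySeries ω j x]
  obtain ⟨ε, hε, D, hD⟩ := hω.exists_decay hρ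
  have hπ := Real.pi_pos
  have key : ∀ i : ℕ, ε * (i + 1 : ℝ) ≤ 4 + max (D + Real.log (2 * C)) 0 := by
    intro i
    set E := max (D + Real.log (2 * C)) 0 with hE
    have hnj : (1 : ℝ) ≤ n i * j i := by
      have h1 : (1 : ℝ) ≤ n i := by exact_mod_cast hn i
      have h2 : (1 : ℝ) ≤ j i := by exact_mod_cast hj i
      exact one_le_mul_of_one_le_of_one_le h1 h2
    have hnω : 1 ≤ n i * ω (j i) :=
      one_le_mul_of_one_le_of_one_le (by exact_mod_cast hn i) (hωj i)
    have hlow := hω.le_integral_inv_one_sub_lacunarySeries j i (n i)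
    have hup := hD (n i * j i) hnj (2 * Real.pi * C)
      (∫ x in (-Real.pi)..Real.pi, G x * Real.cos ((n i * j i : ℤ) * x)) (by positivity)
      fun k => by
        have h1 := abs_integral_mul_cos_le hGs hGp (n i * j i) k (hGb k) 0
        simp only [add_zero] at h1
        have h2 : |(((n i * j i : ℤ)) : ℝ)| = n i * j i := by
          push_cast
          exact abs_of_nonneg (by positivity)
        rw [h2, ← mul_assoc] at h1
        exact (mul_le_mul_of_nonneg_right (le_abs_self _) (by positivity)).trans h1
    -- The power (1/2)^{i+3} is at least exp(-(i + 3) ω(j_i)), as ω(j_i) ≥ 1 and exp(-1) ≤ 1/2;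
    -- adding i + 1 gives 2i + 4.
    have hcoef : Real.exp (-((2 * i + 4) * ω (j i))) ≤ lacunaryCoeff ω j i / 2 := by
      have h1 : Real.exp (-1) ≤ 1 / 2 := by
        rw [Real.exp_neg, one_div]
        gcongr
        have := Real.add_one_le_exp (1 : ℝ)
        linarith
      calc Real.exp (-((2 * i + 4) * ω (j i)))
          ≤ Real.exp (((i + 3 : ℕ) : ℝ) * (-1) + -((i + 1) * ω (j i))) := by
            refine Real.exp_le_exp.2 ?_
            have := mul_le_mul_of_nonneg_left (hωj i) (show (0 : ℝ) ≤ i + 3 by positivity)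
            push_cast
            linarith
        _ = Real.exp (-1) ^ (i + 3) * Real.exp (-((i + 1) * ω (j i))) := by
            rw [Real.exp_add, Real.exp_nat_mul]
        _ ≤ (1 / 2) ^ (i + 3) * Real.exp (-((i + 1) * ω (j i))) := by gcongr
        _ = _ := by rw [lacunaryCoeff]; ring
    have h1 : Real.exp (n i * -((2 * i + 4) * ω (j i))) ≤
        Real.exp (Real.log (2 * C) + (D - ε * ω (n i * j i))) := by
      rw [Real.exp_nat_mul, Real.exp_add, Real.exp_log (by positivity)]
      refine le_of_mul_le_mul_right ?_ hπ
      calc Real.exp (-((2 * i + 4) * ω (j i))) ^ n i * Real.pi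
          ≤ (lacunaryCoeff ω j i / 2) ^ n i * Real.pi := by gcongr
        _ ≤ _ := hlow
        _ ≤ _ := hup
        _ = _ := by ring
    rw [Real.exp_le_exp] at h1
    have h2 := mul_lt_mul_of_pos_left (hlt i) hε
    have h3 : D + Real.log (2 * C) ≤ E := le_max_left _ _
    have hE0 : 0 ≤ E := le_max_right _ _
    have h4 : E ≤ (i + 1) * (E * (n i * ω (j i))) := by
      have : E ≤ E * (n i * ω (j i)) := le_mul_of_one_le_right hE0 hnω
      have h5 : (0 : ℝ) ≤ i * (E * (n i * ω (j i))) := by positivity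
      linarith
    -- Here 2i + 4 ≤ 4(i + 1), so a common factor (i + 1) n_i ω(j_i) cancels and a bound on i
    -- remains.
    have h5 : (i + 1) * (n i * ω (j i)) * (ε * (i + 1 : ℝ)) ≤
        (i + 1) * (n i * ω (j i)) * (4 + E) := by
      have h6 : (0 : ℝ) ≤ i * (n i * ω (j i)) := by positivity
      linarith
    exact le_of_mul_le_mul_left h5 (by positivity)
  obtain ⟨i, hi⟩ := exists_nat_gt ((4 + max (D + Real.log (2 * C)) 0) / ε)
  rw [div_lt_iff₀ hε] at hi
  have := key i
  linarith

lemma beurlingWeight_subset_roumieuWeight (ω : ℝ → ℝ) (n : ℕ) (U : Set (Rn n)) :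
    beurlingWeight ω n U ⊆ roumieuWeight ω n U :=
  fun _ hf => ⟨hf.1, 1, one_pos, hf.2 1 one_pos⟩

theorem sublinearGrowth_of_stable_roumieu (hω : IsWeightFunction ω)
    (hωo : ω =o[atTop] (fun t : ℝ => t)) (h : StableUnderComposition (roumieuWeight ω)) :
    SublinearGrowth ω :=
  hω.sublinearGrowth_of_comp_mem hωo fun U V hU hV g hg hgUV f hf =>
    h 1 1 U V hU hV g (fun l => beurlingWeight_subset_roumieuWeight _ _ _ (hg l)) hgUV f
      (beurlingWeight_subset_roumieuWeight _ _ _ hf)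

theorem sublinearGrowth_of_stable_beurling (hω : IsWeightFunction ω)
    (hωo : ω =o[atTop] (fun t : ℝ => t)) (h : StableUnderComposition (beurlingWeight ω)) :
    SublinearGrowth ω :=
  hω.sublinearGrowth_of_comp_mem hωo fun U V hU hV g hg hgUV f hf =>
    beurlingWeight_subset_roumieuWeight _ _ _ (h 1 1 U V hU hV g hg hgUV f hf)

end IsWeightFunction
end Ultradiff

/-! ### The equivalences. -/

theorem theorem11 (ω : ℝ → ℝ) (hω : Ultradiff.IsWeightFunction ω)
    (hωo : ω =o[atTop] (fun t : ℝ => t)) :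
    List.TFAE [
      ∃ σ : ℝ → ℝ, Ultradiff.IsWeightFunction σ ∧ ConcaveOn ℝ (Ici 0) σ ∧
        Ultradiff.WeightEquiv ω σ,
      ∃ C : ℝ, 0 < C ∧ ∃ t₀ : ℝ, 0 < t₀ ∧ ∀ l : ℝ, 1 ≤ l → ∀ t : ℝ, t₀ ≤ t →
        ω (l * t) ≤ C * l * ω t,
      Ultradiff.StableUnderComposition (Ultradiff.roumieuWeight ω),
      Ultradiff.StableUnderComposition (Ultradiff.beurlingWeight ω),
      ∃ 𝔖 : Set (ℕ → ℝ), Ultradiff.IsWeightMatrix 𝔖 ∧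
        (∀ S ∈ 𝔖, Ultradiff.StronglyLogConvex S) ∧
        Ultradiff.SameClass (Ultradiff.roumieuWeight ω) (Ultradiff.roumieuMatrix 𝔖),
      ∃ 𝔖 : Set (ℕ → ℝ), Ultradiff.IsWeightMatrix 𝔖 ∧
        (∀ S ∈ 𝔖, Ultradiff.StronglyLogConvex S) ∧
        Ultradiff.SameClass (Ultradiff.beurlingWeight ω) (Ultradiff.beurlingMatrix 𝔖),
      Ultradiff.RGood ω,
      Ultradiff.BGood ω] := by
  tfae_have 1 → 2 := fun ⟨_, hσ, hconc, h⟩ => hω.sublinearGrowth_of_weightEquiv hσ hconc h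
  tfae_have 2 → 1 := fun h => ⟨_, hω.concaveMajorant_isWeightFunction hωo,
    hω.concaveOn_concaveMajorant hωo, hω.weightEquiv_concaveMajorant hωo h⟩
  tfae_have 2 → 5 := fun h => ⟨_, hω.isWeightMatrix_majorantMatrix,
    hω.stronglyLogConvex_of_mem_majorantMatrix, hω.sameClass_roumieu_majorantMatrix hωo h⟩
  tfae_have 2 → 6 := fun h => ⟨_, hω.isWeightMatrix_majorantMatrix,
    hω.stronglyLogConvex_of_mem_majorantMatrix, hω.sameClass_beurling_majorantMatrix hωo h⟩
  tfae_have 5 → 7 := fun ⟨_, h𝔖, hS, h⟩ => Ultradiff.rGood_of_stronglyLogConvex h𝔖 hS h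
  tfae_have 6 → 8 := fun ⟨_, h𝔖, hS, h⟩ => Ultradiff.bGood_of_stronglyLogConvex h𝔖 hS h
  tfae_have 7 → 3 := fun h => h.stable
  tfae_have 8 → 4 := fun h => h.stable
  tfae_have 3 → 2 := fun h => hω.sublinearGrowth_of_stable_roumieu hωo h
  tfae_have 4 → 2 := fun h => hω.sublinearGrowth_of_stable_beurling hωo h
  tfae_finish
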